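/- **Theorem (Type-2 FCSA+FCC codes).** Let $\mathbb F$ be a finite field and let $L_A,L_B,\alpha,\beta,\gamma,m,p,n$ be positive integers with $m\mid\alpha$, $p\mid\beta$, $n\mid\gamma$. Let $\mathcal S\subseteq[L_A]\times[L_B]$ be a computation list in which every $i\in[L_A]$ and every $j\in[L_B]$ occurs, and put $d^A_i=|\{j:(i,j)\in\mathcal S\}|$. Let $R=R_{m,p,n}$ be the bilinear complexity over $\mathbb F$ of multiplying an $m\times p$ by a $p\times n$ matrix, that is, the least $R$ for which there are tensors $a\in\mathbb F^{R\times m\times p}$, $b\in\mathbb F^{R\times p\times n}$, $c\in\mathbb F^{R\times m\times n}$ with $\sum_{r}c_{r,j,k}\big(\sum_{q,l}a_{r,q,l}A_{q,l}\big)\big(\sum_{l,s}b_{r,l,s}B_{l,s}\big)=(AB)_{j,k}$ for all $A,B,j,k$. Let $\rho\mid R$, let $K\ge 0$ be the number of workers, and assume $|\mathbb F|>R\,L_A+K$. *Type-2 task and power assignment.* There is one task group $\{q\}\times\{j:(q,j)\in\mathcal S\}$ for each $q\in[L_A]$. In general, for task groups $\mathcal L_A^q\times\mathcal L_B^q$ with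 $L_A^q=|\mathcal L_A^q|$ and $L_B^q=|\mathcal L_B^q|$, a power assignment consists of non-negative integers $P^{A,q}_i$, $P^{B,q}_j$ such that, for every $q$: $P^{A,q}_i=0$ for $i\notin\mathcal L_A^q$ and $P^{B,q}_j=0$ for $j\notin\mathcal L_B^q$; the non-zero $P^{A,q}_i$ are distinct, and so are the non-zero $P^{B,q}_j$; and at least one of the following holds: (i) on the group, every $P^{A,q}_i$ is of the form $L^q_AL^q_B-x+1$ with $x\in[L^q_A]$ and every $P^{B,q}_j$ is of the form $yL^q_A$ with $y\in[L^q_B]$; (ii) the same with the roles of $A$ and $B$ exchanged. Let $P$ be any power assignment for the Type-2 task groups, and define $$R^{T2}=(R+\rho)|\mathcal S|-\min_{i:\,d^A_i\ne0}d^A_i-\min_{j\in[L_B]}\sum_{q=1}^{L_A}P^{B,q}_j+1 .$$ *Code.* Choose tensors $a,b,c$ that attain $R$, and pairwise distinct elements $f_{r,q}$ ($r\in[R]$, $q\in[L_A]$), $x_k$ ($k\in[K]$) of $\mathbb F$; such choices exist. Partition $\mathbf A_i\in\mathbb F^{\alpha\times\beta}$ into $m\times p$ and $\mathbf B_j\in\mathbb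 F^{\beta\times\gamma}$ into $p\times n$ blocks of equal size, put $\mathbf A_i^r=\sum_{k,l}a_{r,k,l}\mathbf A_i^{k,l}$ and $\mathbf B_j^r=\sum_{k,l}b_{r,k,l}\mathbf B_j^{k,l}$, split $[R]$ into $R/\rho$ consecutive parts $I_h$ of length $\rho$, and let $$\mathbf A^h(z)=\prod_{q}\prod_{r\in I_h}(z-f_{r,q})^{d^A_q}\sum_i\sum_{r\in I_h}\frac{\mathbf A_i^r}{\prod_q(z-f_{r,q})^{P^{A,q}_i}},\qquad \mathbf B^h(z)=\sum_j\sum_{r\in I_h}\frac{\mathbf B_j^r}{\prod_q(z-f_{r,q})^{P^{B,q}_j}} .$$ Worker $k$ receives the horizontal concatenation of the $\mathbf A^h(x_k)$ and the vertical concatenation of the $\mathbf B^h(x_k)$, and responds with the product $\widetilde{\mathbf C}_k=\sum_h\mathbf A^h(x_k)\mathbf B^h(x_k)$. *Claim.* There is an absolute constant $C>0$ such that, for all of the above data and every choice in the construction, there are decoding functions $d_{\mathcal R}$ $(\mathcal R\subseteq[K])$ with the following properties for every $\mathcal R$ with $|\mathcal R|\ge R^{T2}$. 1. (Recovery threshold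 $R^{T2}$.) For all matrices $\mathbf A_1,\dots,\mathbf A_{L_A}$, $\mathbf B_1,\dots,\mathbf B_{L_B}$, applying $d_{\mathcal R}$ to the responses $(\widetilde{\mathbf C}_k)_{k\in\mathcal R}$ gives $(\mathbf A_i\mathbf B_j)_{(i,j)\in\mathcal S}$. 2. (Decoding complexity $\mathcal O(\alpha\gamma R|\mathcal S|)+\widetilde{\mathcal O}(\alpha\gamma(R^{T2}\log^2R^{T2}+R|\mathcal S|^2))$, where $\widetilde{\mathcal O}(N\log^2 N)$ stands for $\mathcal O(N\log^2N\log\log N)$.) The function $d_{\mathcal R}$ is computed by an arithmetic straight-line program over $\mathbb F$ (additions, subtractions and multiplications; the program and its constants may depend on everything except the matrices) with at most $$C\,\alpha\gamma R|\mathcal S|+C\,\alpha\gamma\big(R^{T2}\log^2R^{T2}\,\log\log R^{T2}+R|\mathcal S|^2\big)$$ operations, where the term with $\log\log R^{T2}$ is read as $0$ if $R^{T2}=1$. -/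

import Mathlib

open Finset

universe u

/-! ## Bilinear complexity of matrix multiplication -/

/-- Tensors `a, b, c` that compute the product of an `m × p` and a `p × n` matrix over `F`
by `R` multiplications. -/
structure BilinearAlgorithm (F : Type u) [Field F] (m p n R : ℕ) where
  a : Fin R → Fin m → Fin p → F
  b : Fin R → Fin p → Fin n → F
  c : Fin R → Fin m → Fin n → F
  computes : ∀ (A : Matrix (Fin m) (Fin p) F) (B : Matrix (Fin p) (Fin n) F)
    (j : Fin m) (k : Fin n),
    ∑ r, c r j k * (∑ q, ∑ l, a r q l * A q l) * (∑ l, ∑ s, b r l s * B l s) = (A * B) j k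

/-- The bilinear complexity `R_{m,p,n}` over `F`: the least number of multiplications. -/
noncomputable def bilinearComplexity (F : Type u) [Field F] (m p n : ℕ) : ℕ :=
  sInf {R | Nonempty (BilinearAlgorithm F m p n R)}

/-! ## Computation lists, task assignments, power assignments -/

/-- `d^A_i`, the number of `j` with `(i, j) ∈ S`. -/
def degA {LA LB : ℕ} (S : Finset (Fin LA × Fin LB)) (i : Fin LA) : ℕ :=
  #{j : Fin LB | (i, j) ∈ S}

/-- `d^B_j`, the number of `i` with `(i, j) ∈ S`. -/
def degB {LA LB : ℕ} (S : Finset (Fin LA × Fin LB)) (j : Fin LB) : ℕ :=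
  #{i : Fin LA | (i, j) ∈ S}

/-- A task assignment with `Q` task groups `𝓛_A^q × 𝓛_B^q` for the computation list `S`. -/
structure TaskAssignment {LA LB : ℕ} (S : Finset (Fin LA × Fin LB)) (Q : ℕ) where
  groupA : Fin Q → Finset (Fin LA)
  groupB : Fin Q → Finset (Fin LB)
  disjoint : ∀ q q', q ≠ q' → Disjoint (groupA q ×ˢ groupB q) (groupA q' ×ˢ groupB q')
  covers : ∀ s ∈ S, ∃! q, s ∈ groupA q ×ˢ groupB q

/-- `L_A^q * L_B^q`, the number of products in the group `q`. -/
def TaskAssignment.size {LA LB Q : ℕ} {S : Finset (Fin LA × Fin LB)}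
    (T : TaskAssignment S Q) (q : Fin Q) : ℕ :=
  #(T.groupA q) * #(T.groupB q)

/-- A power assignment `(P^{A,q}, P^{B,q})_q` for a task assignment. The equation
`P^{A,q}_i = L_A^q L_B^q - x + 1` is written without subtraction. -/
structure PowerAssignment {LA LB Q : ℕ} {S : Finset (Fin LA × Fin LB)}
    (T : TaskAssignment S Q) where
  powA : Fin Q → Fin LA → ℕ
  powB : Fin Q → Fin LB → ℕ
  powA_eq_zero : ∀ q, ∀ i ∉ T.groupA q, powA q i = 0
  powB_eq_zero : ∀ q, ∀ j ∉ T.groupB q, powB q j = 0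
  admissible : ∀ q,
    ((∀ i ∈ T.groupA q, ∃ x ∈ Finset.Icc 1 #(T.groupA q), powA q i + x = T.size q + 1) ∧
      (∀ j ∈ T.groupB q, ∃ y ∈ Finset.Icc 1 #(T.groupB q), powB q j = y * #(T.groupA q))) ∨
    ((∀ j ∈ T.groupB q, ∃ x ∈ Finset.Icc 1 #(T.groupB q), powB q j + x = T.size q + 1) ∧
      (∀ i ∈ T.groupA q, ∃ y ∈ Finset.Icc 1 #(T.groupA q), powA q i = y * #(T.groupB q)))
  powA_distinct : ∀ q i i', powA q i ≠ 0 → powA q i' ≠ 0 → powA q i = powA q i' → i = i'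
  powB_distinct : ∀ q j j', powB q j ≠ 0 → powB q j' ≠ 0 → powB q j = powB q j' → j = j'

/-- The Type-2 task assignment: one group per `A_i`, consisting of `A_i` and of all `B_j` with
`(i, j) ∈ S`. -/
def type2Task {LA LB : ℕ} (S : Finset (Fin LA × Fin LB)) : TaskAssignment S LA where
  groupA i := {i}
  groupB i := {j : Fin LB | (i, j) ∈ S}
  disjoint q q' h := by
    rw [Finset.disjoint_left]
    rintro ⟨i, j⟩ h1 h2
    simp only [mem_product, mem_singleton] at h1 h2
    exact h (h1.1.symm.trans h2.1)
  covers := by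
    rintro ⟨i, j⟩ h
    refine ⟨i, by simpa using h, fun q hq => ?_⟩
    simp only [mem_product, mem_singleton] at hq
    exact hq.1.symm

/-- The recovery threshold
`(R + ρ)|S| - min_{i : d^A_i ≠ 0} d^A_i - min_j ∑_q P^{B,q}_j + 1` of the Type-2 codes. -/
noncomputable def type2Threshold {LA LB : ℕ} (S : Finset (Fin LA × Fin LB))
    (P : PowerAssignment (type2Task S)) (R ρ : ℕ) : ℤ :=
  ((R : ℤ) + ρ) * #S - ((⨅ i : {i : Fin LA // degA S i ≠ 0}, degA S i.1 : ℕ) : ℤ)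
    - ((⨅ j : Fin LB, ∑ q, P.powB q j : ℕ) : ℤ) + 1

/-! ## The encoders of the FCSA+FCC codes -/

/-- Position `s` inside the `k`-th of `m` consecutive blocks of length `α / m`. -/
def blockIndex {α m : ℕ} (k : Fin m) (s : Fin (α / m)) : Fin α :=
  ⟨k * (α / m) + s, by
    have h1 : ((k : ℕ) + 1) * (α / m) ≤ m * (α / m) := Nat.mul_le_mul_right _ k.2
    have h2 : m * (α / m) ≤ α := Nat.mul_div_le α m
    have h3 := s.2
    rw [Nat.add_mul, Nat.one_mul] at h1
    omega⟩

/-- The block `M^{k,l}` of a matrix partitioned into `m × p` blocks of equal size. -/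
def matrixBlock {F : Type u} {α β m p : ℕ} (M : Matrix (Fin α) (Fin β) F)
    (k : Fin m) (l : Fin p) : Matrix (Fin (α / m)) (Fin (β / p)) F :=
  Matrix.of fun s t => M (blockIndex k s) (blockIndex l t)

/-- The free choices in the FCSA+FCC construction: optimal tensors for the bilinear complexity,
and pairwise distinct field elements `f_{r,q}` (one for each of the `R_{m,p,n}` instances and
each of the `Q` task groups) and `x_k` (one for each of the `K` workers). -/
structure FCCChoice (F : Type u) [Field F] (m p n Q K : ℕ) where
  tensors : BilinearAlgorithm F m p n (bilinearComplexity F m p n)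
  f : Fin (bilinearComplexity F m p n) → Fin Q → F
  x : Fin K → F
  distinct : Function.Injective
    (Sum.elim (fun rq : Fin (bilinearComplexity F m p n) × Fin Q => f rq.1 rq.2) x)

namespace FCCChoice

variable {F : Type u} [Field F] {m p n Q K : ℕ} (D : FCCChoice F m p n Q K)

/-- `A_i^r = ∑_{k,l} a_{r,k,l} A_i^{k,l}`. -/
noncomputable def subA {α β : ℕ} (r : Fin (bilinearComplexity F m p n)) (M : Matrix (Fin α) (Fin β) F) :
    Matrix (Fin (α / m)) (Fin (β / p)) F :=
  ∑ k, ∑ l, D.tensors.a r k l • matrixBlock M k l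

/-- `B_j^r = ∑_{k,l} b_{r,k,l} B_j^{k,l}`. -/
noncomputable def subB {β γ : ℕ} (r : Fin (bilinearComplexity F m p n)) (M : Matrix (Fin β) (Fin γ) F) :
    Matrix (Fin (β / p)) (Fin (γ / n)) F :=
  ∑ k, ∑ l, D.tensors.b r k l • matrixBlock M k l

/-- The instances `r` in the `h`-th of the `R / ρ` consecutive parts of length `ρ`. -/
noncomputable def part (F : Type u) [Field F] (m p n ρ : ℕ) (h : Fin (bilinearComplexity F m p n / ρ)) :
    Finset (Fin (bilinearComplexity F m p n)) :=
  Finset.univ.filter fun r => (r : ℕ) / ρ = h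

variable {LA LB : ℕ} {S : Finset (Fin LA × Fin LB)} {T : TaskAssignment S Q}
  (P : PowerAssignment T)

/-- `a_i^r(z) = ∏_q (z - f_{r,q}) ^ P^{A,q}_i`. -/
noncomputable def denA (r : Fin (bilinearComplexity F m p n)) (i : Fin LA) (z : F) : F :=
  ∏ q, (z - D.f r q) ^ P.powA q i

/-- `b_j^r(z) = ∏_q (z - f_{r,q}) ^ P^{B,q}_j`. -/
noncomputable def denB (r : Fin (bilinearComplexity F m p n)) (j : Fin LB) (z : F) : F :=
  ∏ q, (z - D.f r q) ^ P.powB q j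

/-- `Θ_h(z) = ∏_q ∏_{r in part h} (z - f_{r,q}) ^ (L_A^q L_B^q)`. -/
noncomputable def theta (T : TaskAssignment S Q) (ρ : ℕ) (h : Fin (bilinearComplexity F m p n / ρ)) (z : F) :
    F :=
  ∏ q, ∏ r ∈ part F m p n ρ h, (z - D.f r q) ^ T.size q

/-- `A^h(z) = Θ_h(z) ∑_i ∑_{r in part h} A_i^r / a_i^r(z)`. -/
noncomputable def polyA {α β : ℕ} (ρ : ℕ) (𝒜 : Fin LA → Matrix (Fin α) (Fin β) F)
    (h : Fin (bilinearComplexity F m p n / ρ)) (z : F) :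
    Matrix (Fin (α / m)) (Fin (β / p)) F :=
  D.theta T ρ h z • ∑ i, ∑ r ∈ part F m p n ρ h, (D.denA P r i z)⁻¹ • D.subA r (𝒜 i)

/-- `B^h(z) = ∑_j ∑_{r in part h} B_j^r / b_j^r(z)`. -/
noncomputable def polyB {β γ : ℕ} (ρ : ℕ) (ℬ : Fin LB → Matrix (Fin β) (Fin γ) F)
    (h : Fin (bilinearComplexity F m p n / ρ)) (z : F) :
    Matrix (Fin (β / p)) (Fin (γ / n)) F :=
  ∑ j, ∑ r ∈ part F m p n ρ h, (D.denB P r j z)⁻¹ • D.subB r (ℬ j)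

/-- What source `𝔸` sends to worker `k`: the horizontal concatenation of the `A^h(x_k)`. -/
noncomputable def encodeA {α β : ℕ} (ρ : ℕ) (𝒜 : Fin LA → Matrix (Fin α) (Fin β) F) (k : Fin K) :
    Matrix (Fin (α / m)) (Fin (bilinearComplexity F m p n / ρ) × Fin (β / p)) F :=
  Matrix.of fun s ht => D.polyA P ρ 𝒜 ht.1 (D.x k) s ht.2

/-- What source `𝔹` sends to worker `k`: the vertical concatenation of the `B^h(x_k)`. -/
noncomputable def encodeB {β γ : ℕ} (ρ : ℕ) (ℬ : Fin LB → Matrix (Fin β) (Fin γ) F) (k : Fin K) :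
    Matrix (Fin (bilinearComplexity F m p n / ρ) × Fin (β / p)) (Fin (γ / n)) F :=
  Matrix.of fun hs t => D.polyB P ρ ℬ hs.1 (D.x k) hs.2 t

/-- The response of worker `k`: the product of the two matrices it has received. -/
noncomputable def response {α β γ : ℕ} (ρ : ℕ) (𝒜 : Fin LA → Matrix (Fin α) (Fin β) F)
    (ℬ : Fin LB → Matrix (Fin β) (Fin γ) F) (k : Fin K) :
    Matrix (Fin (α / m)) (Fin (γ / n)) F :=
  D.encodeA P ρ 𝒜 k * D.encodeB P ρ ℬ k

end FCCChoice

/-! ## Straight-line programs: decoding with a count of field operations -/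

/-- An operand of an instruction: an input, a constant, or the result of the `k`-th instruction. -/
inductive Operand (F ι : Type*) where
  | input (i : ι)
  | const (c : F)
  | reg (k : ℕ)

/-- An instruction of an arithmetic straight-line program. -/
inductive Instruction (F ι : Type*) where
  | plus (s t : Operand F ι)
  | minus (s t : Operand F ι)
  | times (s t : Operand F ι)

/-- The value of an operand, given the inputs and the results obtained so far. -/
def Operand.value {F ι : Type*} [Field F] (v : ι → F) (regs : List F) : Operand F ι → F
  | .input i => v i
  | .const c => c
  | .reg k => regs.getD k 0

/-- The result of an instruction: one addition, subtraction or multiplication in `F`. -/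
def Instruction.value {F ι : Type*} [Field F] (v : ι → F) (regs : List F) : Instruction F ι → F
  | .plus s t => s.value v regs + t.value v regs
  | .minus s t => s.value v regs - t.value v regs
  | .times s t => s.value v regs * t.value v regs

/-- An arithmetic straight-line program over `F` with inputs indexed by `ι` and outputs indexed
by `o`. -/
structure StraightLineProgram (F ι o : Type*) where
  code : List (Instruction F ι)
  out : o → Operand F ι

/-- The number of field operations that a program performs. -/
def StraightLineProgram.cost {F ι o : Type*} (d : StraightLineProgram F ι o) : ℕ :=
  d.code.length

/-- The function that a program computes. -/
def StraightLineProgram.eval {F ι o : Type*} [Field F] (d : StraightLineProgram F ι o)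
    (v : ι → F) : o → F :=
  let regs := d.code.foldl (fun regs I => regs ++ [I.value v regs]) []
  fun z => (d.out z).value v regs

/-!
The decoder is a fixed linear map of the responses, since the points `f_{r,q}` and `x_k` are
constants of the program. It is found as follows.

In a Type-2 group the exponents of `A_q` and of the `B_j` are `d_q = d^A_q` and the numbers from
`1` to `d_q` (`powA_eq`, `powB_mem_Icc`, `powB_injOn`). Multiplied by the common denominator
`∏ (X - f_{r,q}) ^ {d_q}`, an entry of the response is a polynomial in `x_k` of degree less than
the threshold `N` (`eval_responsePoly`, `degree_responsePoly_lt`), so `N` responses determine it.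
Modulo `(X - f_{r,q}) ^ {d_q}` only the products `A_q^r B_j^r` with `(q, j) ∈ S` survive, with
cofactors that vanish at `f_{r,q}` to distinct orders below `d_q`; the products are therefore
linear functions of this residue (`responsePoly_modByMonic`, `computes_entry`), and finding all of
them takes `O(R |S|²)` operations. The tensor `c` turns them into the blocks of `A_i B_j` with
`2 R` operations per entry (`mul_blockIndex`).

What remains is to pass from the values of a polynomial of degree less than `N` to its residues.
The values are combined along a balanced binary tree of partial fractions (`computes_numerator`),
and the residues are found along a second tree, whose leaves `(X - f_{r,q}) ^ {d_q}` are balanced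
by degree (`computes_residues`). The moduli are constants, so a division with remainder amounts to
two multiplications by fixed polynomials (`mul_divByMonic_X_pow`), and each of the `O(log N)`
levels costs as much as multiplications by fixed polynomials of total degree `O(N)`.

Multiplication by a fixed polynomial of degree `n` takes `O(n log n log log n)` operations over
every field (`computes_fixed_mul`), by the method of Schönhage, Strassen and Nussbaumer. Let `p`
be `2` or `3`, and different from the characteristic. In an algebra with an element `x` such that
`x ^ (p ^ J)` is a root of `1 + T + ... + T ^ (p - 1)`, put `y = x ^ (p ^ a)` with `a` about
`J / 2`. Elements of `F[x]` are polynomials in `x` of degree less than `p ^ a` over `F[y]`, and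
`F[y]` contains the roots of unity that a fast Fourier transform of this length needs, where
multiplication by a root of unity is a cyclic shift (`computes_mul_mod`). This reduces the problem
for `J` to the one for `J / 2` (`canMul_step`, `canMul_fast`).

Operations are counted by the relation `Computes` between sets of functions of the matrices;
`Computes.exists_program` turns it into a straight-line program.
-/

universe v w

/-! ### Sets of functions computed by arithmetic operations -/

namespace FastDecoding

variable {F : Type u} {Ω : Type v}

/-- The functions `Ω → F` that an instruction may use once those in `A` are known: the members of
`A` and the constants. -/
def withConsts (A : Set (Ω → F)) : Set (Ω → F) :=
  {φ | φ ∈ A ∨ ∃ a : F, φ = fun _ => a}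

theorem subset_withConsts (A : Set (Ω → F)) : A ⊆ withConsts A := fun _ h => Or.inl h

theorem const_mem_withConsts (A : Set (Ω → F)) (a : F) : (fun _ => a) ∈ withConsts A :=
  Or.inr ⟨a, rfl⟩

theorem withConsts_subset_iff {A B : Set (Ω → F)} :
    withConsts A ⊆ withConsts B ↔ A ⊆ withConsts B := by
  refine ⟨fun h => (subset_withConsts A).trans h, fun h φ hφ => ?_⟩
  rcases hφ with hφ | hφ
  · exact h hφ
  · exact Or.inr hφ

theorem withConsts_mono {A B : Set (Ω → F)} (h : A ⊆ B) : withConsts A ⊆ withConsts B :=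
  withConsts_subset_iff.2 (h.trans (subset_withConsts B))

variable [Field F]

/-- `Computes A c B`: from the functions in `A` and constants, all functions in `B` are obtained by
at most `c` pointwise additions, subtractions and multiplications. -/
inductive Computes : Set (Ω → F) → ℕ → Set (Ω → F) → Prop
  | done {A B : Set (Ω → F)} {c : ℕ} : B ⊆ withConsts A → Computes A c B
  | step {A B : Set (Ω → F)} {c : ℕ} {φ ψ χ : Ω → F} :
      φ ∈ withConsts A → ψ ∈ withConsts A → (χ = φ + ψ ∨ χ = φ - ψ ∨ χ = φ * ψ) →
      Computes (insert χ A) c B → Computes A (c + 1) B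

namespace Computes

variable {A A' B B' : Set (Ω → F)} {c c' : ℕ}

theorem mono_cost (h : Computes A c B) : ∀ {c' : ℕ}, c ≤ c' → Computes A c' B := by
  induction h with
  | done h => exact fun _ => done h
  | step h1 h2 h3 _ ih =>
    intro c' hc
    obtain ⟨k, rfl⟩ : ∃ k, c' = k + 1 := ⟨c' - 1, by omega⟩
    exact step h1 h2 h3 (ih (by omega))

theorem mono_source (h : Computes A c B) : ∀ {A' : Set (Ω → F)}, A ⊆ withConsts A' →
    Computes A' c B := by
  induction h with
  | done h => exact fun hA => done (h.trans (withConsts_subset_iff.2 hA))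
  | @step A B c φ ψ χ h1 h2 h3 _ ih =>
    intro A' hA
    have hA' := withConsts_subset_iff.2 hA
    refine step (hA' h1) (hA' h2) h3 (ih ?_)
    rw [Set.insert_subset_iff]
    exact ⟨subset_withConsts _ (Set.mem_insert _ _),
      hA.trans (withConsts_mono (Set.subset_insert _ _))⟩

theorem mono_target (h : Computes A c B) : ∀ {B' : Set (Ω → F)}, B' ⊆ withConsts B →
    Computes A c B' := by
  induction h with
  | done h => exact fun hB => done (hB.trans (withConsts_subset_iff.2 h))
  | step h1 h2 h3 _ ih => exact fun hB => step h1 h2 h3 (ih hB)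

theorem trans (h : Computes A c B) (h' : Computes B c' B') : Computes A (c + c') B' := by
  induction h with
  | done h => exact (h'.mono_source h).mono_cost (by omega)
  | @step A B c φ ψ χ h1 h2 h3 _ ih =>
    have := step h1 h2 h3 (ih h')
    exact this.mono_cost (by omega)

theorem union_free (h : Computes A c B) : ∀ {B' : Set (Ω → F)}, B' ⊆ withConsts A →
    Computes A c (B' ∪ B) := by
  induction h with
  | done h => exact fun hB => done (Set.union_subset hB h)
  | step h1 h2 h3 _ ih =>
    exact fun hB => step h1 h2 h3 (ih (hB.trans (withConsts_mono (Set.subset_insert _ _))))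

/-- Known functions remain known. -/
theorem keep (h : Computes A c B) : Computes A c (A ∪ B) := h.union_free (subset_withConsts A)

theorem union (h : Computes A c B) (h' : Computes A c' B') : Computes A (c + c') (B ∪ B') := by
  have h2 : Computes (A ∪ B) c' (B ∪ B') :=
    (h'.mono_source (Set.subset_union_left.trans (subset_withConsts _))).union_free
      (Set.subset_union_right.trans (subset_withConsts _))
  exact h.keep.trans h2

theorem biUnion {ι : Type*} (s : Finset ι) (c : ι → ℕ) (B : ι → Set (Ω → F))
    (h : ∀ i ∈ s, Computes A (c i) (B i)) : Computes A (∑ i ∈ s, c i) (⋃ i ∈ s, B i) := by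
  classical
  induction s using Finset.induction_on with
  | empty => exact done (by simp)
  | insert i s hi ih =>
    rw [Finset.sum_insert hi, Finset.set_biUnion_insert]
    exact (h i (mem_insert_self _ _)).union (ih fun j hj => h j (mem_insert_of_mem hj))

/-- Goals that persist when more functions become known can be pursued one after the other. -/
theorem exists_forall {ι : Type*} [Fintype ι] (Φ : ι → Set (Ω → F) → Prop)
    (hΦ : ∀ i B B', B ⊆ B' → Φ i B → Φ i B') (c : ι → ℕ)
    (h : ∀ i, ∃ B, Computes A (c i) B ∧ Φ i B) :
    ∃ B, Computes A (∑ i, c i) B ∧ ∀ i, Φ i B := by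
  choose B hB hB' using h
  refine ⟨_, biUnion univ c B fun i _ => hB i, fun i => hΦ i _ _ ?_ (hB' i)⟩
  exact Set.subset_biUnion_of_mem (u := B) (mem_coe.2 (mem_univ i))

theorem add {φ ψ : Ω → F} (hφ : φ ∈ withConsts A) (hψ : ψ ∈ withConsts A) :
    Computes A 1 {φ + ψ} :=
  step hφ hψ (Or.inl rfl) (done (by
    rw [Set.singleton_subset_iff]; exact subset_withConsts _ (Set.mem_insert _ _)))

theorem sub {φ ψ : Ω → F} (hφ : φ ∈ withConsts A) (hψ : ψ ∈ withConsts A) :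
    Computes A 1 {φ - ψ} :=
  step hφ hψ (Or.inr (Or.inl rfl)) (done (by
    rw [Set.singleton_subset_iff]; exact subset_withConsts _ (Set.mem_insert _ _)))

theorem const_mul (a : F) {φ : Ω → F} (hφ : φ ∈ withConsts A) :
    Computes A 1 {fun ω => a * φ ω} :=
  step (const_mem_withConsts A a) hφ (Or.inr (Or.inr rfl)) (done (by
    rw [Set.singleton_subset_iff]; exact subset_withConsts _ (Set.mem_insert _ _)))

theorem range {ι : Type*} [Fintype ι] (φ : ι → Ω → F) (h : ∀ i, Computes A c {φ i}) :
    Computes A (Fintype.card ι * c) (Set.range φ) := by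
  have := biUnion univ (fun _ => c) (fun i => {φ i}) (fun i _ => h i)
  rw [sum_const, card_univ, smul_eq_mul] at this
  refine this.mono_target ?_
  rintro _ ⟨i, rfl⟩
  exact Or.inl (by simp)

theorem linear_combination {ι : Type*} (s : Finset ι) (a : ι → F) (φ : ι → Ω → F)
    (h : ∀ i ∈ s, φ i ∈ withConsts A) :
    Computes A (2 * #s) {fun ω => ∑ i ∈ s, a i * φ i ω} := by
  classical
  induction s using Finset.induction_on with
  | empty => exact done (by simpa using const_mem_withConsts A 0)
  | insert i s hi ih =>
    have h1 := (const_mul (a i) (h i (mem_insert_self _ _))).union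
      (ih fun j hj => h j (mem_insert_of_mem hj))
    have h2 := h1.trans (add (φ := fun ω => a i * φ i ω) (ψ := fun ω => ∑ i ∈ s, a i * φ i ω)
      (Or.inl (Or.inl rfl)) (Or.inl (Or.inr rfl)))
    rw [card_insert_of_notMem hi]
    refine (h2.mono_cost (by omega)).mono_target ?_
    rw [Set.singleton_subset_iff]
    refine Or.inl ?_
    rw [Set.mem_singleton_iff]
    funext ω
    simp [sum_insert hi]

end Computes

/-! ### Straight-line programs -/

/-- The results of the instructions of a program. -/
def runCode {ι : Type*} (code : List (Instruction F ι)) (v : ι → F) : List F :=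
  code.foldl (fun regs I => regs ++ [I.value v regs]) []

theorem runCode_append_singleton {ι : Type*} (code : List (Instruction F ι))
    (I : Instruction F ι) (v : ι → F) :
    runCode (code ++ [I]) v = runCode code v ++ [I.value v (runCode code v)] := by
  simp [runCode]

theorem length_runCode {ι : Type*} (code : List (Instruction F ι)) (v : ι → F) :
    (runCode code v).length = code.length := by
  induction code using List.reverseRecOn with
  | nil => rfl
  | append_singleton l I ih => rw [runCode_append_singleton]; simp [ih]

/-- The functions of `ω` that an operand can denote after `code` has run on the input `inp · ω`;
registers that are not yet written are excluded, since their default value is not stable. -/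
def operandFunctions {ι : Type*} (inp : ι → Ω → F) (code : List (Instruction F ι)) :
    Set (Ω → F) :=
  {φ | ∃ s : Operand F ι, (∀ k, s = .reg k → k < code.length) ∧
    ∀ ω, s.value (fun i => inp i ω) (runCode code fun i => inp i ω) = φ ω}

theorem operandFunctions_append {ι : Type*} (inp : ι → Ω → F) (code : List (Instruction F ι))
    (I : Instruction F ι) :
    operandFunctions inp code ⊆ operandFunctions inp (code ++ [I]) := by
  rintro φ ⟨s, hs, hφ⟩
  refine ⟨s, fun k hk => (hs k hk).trans (by simp), fun ω => ?_⟩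
  rw [← hφ ω, runCode_append_singleton]
  cases s with
  | input i => rfl
  | const a => rfl
  | reg k =>
    simp only [Operand.value]
    rw [List.getD_append]
    rw [length_runCode]
    exact hs k rfl

theorem withConsts_subset_operandFunctions {ι : Type*} {inp : ι → Ω → F}
    {code : List (Instruction F ι)} {A : Set (Ω → F)} (h : A ⊆ operandFunctions inp code) :
    withConsts A ⊆ operandFunctions inp code := by
  rintro φ (hφ | ⟨a, rfl⟩)
  · exact h hφ
  · exact ⟨.const a, by simp, fun _ => rfl⟩

theorem Computes.exists_code {ι : Type*} (inp : ι → Ω → F) {A B : Set (Ω → F)} {c : ℕ}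
    (h : Computes A c B) : ∀ code : List (Instruction F ι), A ⊆ operandFunctions inp code →
      ∃ code' : List (Instruction F ι), code'.length ≤ code.length + c ∧
        B ⊆ operandFunctions inp code' := by
  induction h with
  | done h =>
    exact fun code hA => ⟨code, by omega, h.trans (withConsts_subset_operandFunctions hA)⟩
  | @step A B c φ ψ χ h1 h2 h3 _ ih =>
    intro code hA
    have hA' := withConsts_subset_operandFunctions hA
    obtain ⟨s, -, hs⟩ := hA' h1
    obtain ⟨t, -, ht⟩ := hA' h2
    obtain ⟨I, hI⟩ : ∃ I : Instruction F ι,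
        ∀ ω, I.value (fun i => inp i ω) (runCode code fun i => inp i ω) = χ ω := by
      rcases h3 with rfl | rfl | rfl
      · exact ⟨.plus s t, fun ω => by simp [Instruction.value, hs, ht]⟩
      · exact ⟨.minus s t, fun ω => by simp [Instruction.value, hs, ht]⟩
      · exact ⟨.times s t, fun ω => by simp [Instruction.value, hs, ht]⟩
    obtain ⟨code', h1, h2⟩ := ih (code ++ [I]) (by
      rw [Set.insert_subset_iff]
      refine ⟨⟨.reg code.length, by simp, fun ω => ?_⟩,
        hA.trans (operandFunctions_append inp code I)⟩
      rw [runCode_append_singleton]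
      simp only [Operand.value]
      rw [List.getD_append_right _ _ _ _ (by rw [length_runCode]), length_runCode]
      simp [hI])
    refine ⟨code', ?_, h2⟩
    simp only [List.length_append, List.length_singleton] at h1
    omega

theorem Computes.exists_program {ι o : Type*} (inp : ι → Ω → F) {B : Set (Ω → F)} {c : ℕ}
    (h : Computes (Set.range inp) c B) (out : o → Ω → F) (hout : ∀ z, out z ∈ withConsts B) :
    ∃ d : StraightLineProgram F ι o, d.cost ≤ c ∧
      ∀ ω, d.eval (fun i => inp i ω) = fun z => out z ω := by
  obtain ⟨code, h1, h2⟩ := h.exists_code inp [] (by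
    rintro _ ⟨i, rfl⟩
    exact ⟨.input i, by simp, fun _ => rfl⟩)
  choose s _ hs using fun z => withConsts_subset_operandFunctions h2 (hout z)
  exact ⟨⟨code, s⟩, by simpa [StraightLineProgram.cost] using h1, fun ω => funext fun z => hs z ω⟩

end FastDecoding

/-! ### Redundant representations in powers of a root of unity -/

namespace FastDecoding

open Polynomial

variable {F : Type u} [Field F] {Ω : Type v} {A : Type w} [CommRing A] [Algebra F A]

/-- The element `x ω` of the algebra `A` is known through some coefficients `c i ω`, taken from `S`,
with `x ω = ∑ i < n, c i ω • y ^ i`. The powers of `y` need not be linearly independent: for a root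
of unity `y` of order `n` this redundancy makes multiplication by `y` a cyclic shift. -/
def Known (y : A) (n : ℕ) (S : Set (Ω → F)) (x : Ω → A) : Prop :=
  ∃ c : Fin n → Ω → F, (∀ i, c i ∈ withConsts S) ∧ ∀ ω, x ω = ∑ i, c i ω • y ^ (i : ℕ)

namespace Known

variable {y : A} {n : ℕ} {S S' : Set (Ω → F)} {x x' : Ω → A}

theorem mono (h : Known y n S x) (hS : S ⊆ withConsts S') : Known y n S' x := by
  obtain ⟨c, hc, hx⟩ := h
  exact ⟨c, fun i => withConsts_subset_iff.2 hS (hc i), hx⟩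

theorem zero : Known y n S (fun _ => (0 : A)) :=
  ⟨fun _ _ => 0, fun _ => const_mem_withConsts S 0, by simp⟩

theorem add (h : Known y n S x) (h' : Known y n S x') :
    ∃ B, Computes S n B ∧ Known y n B (fun ω => x ω + x' ω) := by
  obtain ⟨c, hc, hx⟩ := h
  obtain ⟨c', hc', hx'⟩ := h'
  have := Computes.range (A := S) (fun i => c i + c' i) fun i => Computes.add (hc i) (hc' i)
  rw [Fintype.card_fin, mul_one] at this
  refine ⟨_, this, fun i => c i + c' i, fun i => Or.inl ⟨i, rfl⟩, fun ω => ?_⟩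
  simp [hx, hx', add_smul, sum_add_distrib]

theorem sub (h : Known y n S x) (h' : Known y n S x') :
    ∃ B, Computes S n B ∧ Known y n B (fun ω => x ω - x' ω) := by
  obtain ⟨c, hc, hx⟩ := h
  obtain ⟨c', hc', hx'⟩ := h'
  have := Computes.range (A := S) (fun i => c i - c' i) fun i => Computes.sub (hc i) (hc' i)
  rw [Fintype.card_fin, mul_one] at this
  refine ⟨_, this, fun i => c i - c' i, fun i => Or.inl ⟨i, rfl⟩, fun ω => ?_⟩
  simp [hx, hx', sub_smul, sum_sub_distrib]

theorem sum {ι : Type*} (s : Finset ι) (x : ι → Ω → A) (h : ∀ i ∈ s, Known y n S (x i)) :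
    ∃ B, Computes S (#s * n) B ∧ Known y n B (fun ω => ∑ i ∈ s, x i ω) := by
  classical
  induction s using Finset.induction_on with
  | empty => exact ⟨S, .done (subset_withConsts S), by simpa using zero⟩
  | insert i s hi ih =>
    obtain ⟨B, hB, hx⟩ := ih fun j hj => h j (mem_insert_of_mem hj)
    obtain ⟨B', hB', hx'⟩ := add (S := S ∪ B)
      ((h i (mem_insert_self i s)).mono (Set.subset_union_left.trans (subset_withConsts _)))
      (hx.mono (Set.subset_union_right.trans (subset_withConsts _)))
    refine ⟨B', (hB.keep.trans hB').mono_cost ?_, ?_⟩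
    · rw [card_insert_of_notMem hi]
      exact le_of_eq (by ring)
    · simpa [sum_insert hi] using hx'

/-- Multiplication by a power of the root of unity `y` permutes the coefficients. -/
theorem pow_mul (hy : y ^ n = 1) (h : Known y n S x) (e : ℕ) :
    Known y n S (fun ω => y ^ e * x ω) := by
  obtain ⟨c, hc, hx⟩ := h
  rcases Nat.eq_zero_or_pos n with rfl | hn
  · exact ⟨c, hc, fun ω => by simp [hx]⟩
  have : NeZero n := ⟨hn.ne'⟩
  refine ⟨fun i => c (i - Fin.ofNat n e), fun i => hc _, fun ω => ?_⟩
  simp only [hx, mul_sum]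
  refine Fintype.sum_equiv (Equiv.addRight (Fin.ofNat n e)) _ _ fun i => ?_
  simp only [Equiv.coe_addRight, add_sub_cancel_right, mul_smul_comm]
  congr 1
  rw [← pow_add, Fin.val_add, Fin.val_ofNat, Nat.add_mod_mod, ← pow_eq_pow_mod _ hy, add_comm]

end Known

/-! ### Synthetic roots of unity of prime power order -/

section RootOfUnity

variable {B : Type*} [CommRing B] {p : ℕ} {ζ : B}

theorem pow_eq_one_of_geom_sum_eq_zero (hζ : ∑ i ∈ range p, ζ ^ i = 0) : ζ ^ p = 1 := by
  have := mul_geom_sum ζ p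
  rw [hζ, mul_zero] at this
  exact (sub_eq_zero.1 this.symm)

theorem geom_sum_pow_eq_zero (hp : p.Prime) (hζ : ∑ i ∈ range p, ζ ^ i = 0) {k : ℕ}
    (hk : ¬ p ∣ k) : ∑ i ∈ range p, (ζ ^ k) ^ i = 0 := by
  have : Fact p.Prime := ⟨hp⟩
  have h1 := pow_eq_one_of_geom_sum_eq_zero hζ
  have hval : ∀ ξ : B, ∑ i ∈ range p, ξ ^ i = ∑ i : ZMod p, ξ ^ i.val := by
    intro ξ
    refine sum_bij' (fun i _ => (i : ZMod p)) (fun i _ => i.val) (fun i _ => mem_univ _)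
      (fun i _ => mem_range.2 i.val_lt) (fun i hi => ZMod.val_cast_of_lt (mem_range.1 hi))
      (fun i _ => ZMod.natCast_zmod_val i) (fun i hi => ?_)
    rw [ZMod.val_cast_of_lt (mem_range.1 hi)]
  rw [hval] at hζ ⊢
  rw [← hζ]
  have hk' : (k : ZMod p) ≠ 0 := by rwa [Ne, ZMod.natCast_eq_zero_iff]
  refine Fintype.sum_equiv (Equiv.mulLeft₀ (k : ZMod p) hk') _ _ fun i => ?_
  rw [Equiv.mulLeft₀_apply, ZMod.val_mul, ZMod.val_natCast, ← pow_mul, Nat.mod_mul_mod,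
    ← pow_eq_pow_mod _ h1]

/-- If `p` is invertible, so is `1 - ζ`, with an inverse that is a polynomial in `ζ`. -/
theorem one_sub_mul_sum (hζ : ∑ i ∈ range p, ζ ^ i = 0) :
    (1 - ζ) * ∑ i ∈ range p, (i : B) * ζ ^ i = -p := by
  have key : ∀ k : ℕ, (1 - ζ) * ∑ i ∈ range k, (i : B) * ζ ^ i
      = ∑ i ∈ range k, ζ ^ i * ζ - k * ζ ^ k := by
    intro k
    induction k with
    | zero => simp
    | succ k ih =>
      rw [sum_range_succ, mul_add, ih, sum_range_succ]
      push_cast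
      ring
  rw [key, ← sum_mul, hζ, pow_eq_one_of_geom_sum_eq_zero hζ]
  ring

/-- The Chinese remainder theorem for `T ^ p - w = ∏ i, (T - W i)`, where the `W i` are the `p`-th
roots of `w` and the `V i` their inverses: the residues `E i` of a product are combined to a residue
modulo `T ^ p - w`. The factor `π = p⁻¹` has been put into the residues beforehand. -/
theorem sub_dvd_crt (hp : 0 < p) {T w π P Q : B} {W V E : Fin p → B} (hVW : ∀ i, V i * W i = 1)
    (hW : ∀ i, W i ^ p = w) (hV : ∀ k, 0 < k → k < p → ∑ i, V i ^ k = 0) (hπ : (p : B) * π = 1)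
    (hE : ∀ i, T - W i ∣ E i - P * (π * Q)) :
    T ^ p - w ∣ (∑ i, (∑ k : Fin p, (V i * T) ^ (k : ℕ)) * E i) - P * Q := by
  have hsum : ∑ i, ∑ k : Fin p, (V i * T) ^ (k : ℕ) = (p : B) := by
    rw [sum_comm, sum_eq_single (⟨0, hp⟩ : Fin p)]
    · simp
    · intro k _ hk
      simp only [mul_pow]
      rw [← sum_mul, hV k (Nat.pos_of_ne_zero fun h => hk (Fin.ext h)) k.2, zero_mul]
    · simp
  have hdvd : ∀ i, T ^ p - w ∣ (∑ k : Fin p, (V i * T) ^ (k : ℕ)) * (T - W i) := by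
    intro i
    have h1 : T - W i = W i * (V i * T - 1) := by linear_combination (-T) * hVW i
    have h2 : V i ^ p * w = 1 := by rw [← hW i, ← mul_pow, hVW, one_pow]
    rw [h1, mul_left_comm, Fin.sum_univ_eq_sum_range (fun k => (V i * T) ^ k), geom_sum_mul]
    refine ⟨W i * V i ^ p, ?_⟩
    rw [mul_pow]
    linear_combination W i * h2
  have h3 : (∑ i, (∑ k : Fin p, (V i * T) ^ (k : ℕ)) * E i) - P * Q
      = ∑ i, (∑ k : Fin p, (V i * T) ^ (k : ℕ)) * (E i - P * (π * Q)) := by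
    simp only [mul_sub, sum_sub_distrib]
    rw [← sum_mul, hsum]
    linear_combination P * Q * hπ
  rw [h3]
  refine dvd_sum fun i _ => ?_
  obtain ⟨c, hc⟩ := hE i
  rw [hc, ← mul_assoc]
  exact (hdvd i).mul_right c

theorem sub_dvd_fold {T W : B} (P : Fin p → B) :
    T - W ∣ ∑ k, P k * T ^ (k : ℕ) - ∑ k, P k * W ^ (k : ℕ) := by
  rw [← sum_sub_distrib]
  refine dvd_sum fun k _ => ?_
  rw [← mul_sub]
  exact (sub_dvd_pow_sub_pow T W k).mul_left _

end RootOfUnity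

/-! ### Multiplication by a fixed element -/

/-- Every fixed element of `F[y]` can be multiplied with `c` operations in the redundant
representation of length `n`. -/
def CanMul (F : Type u) [Field F] (Ω : Type v) {A : Type w} [CommRing A] [Algebra F A]
    (y : A) (n c : ℕ) : Prop :=
  ∀ q ∈ Algebra.adjoin F {y}, ∀ (S : Set (Ω → F)) (x : Ω → A), Known y n S x →
    ∃ B, Computes S c B ∧ Known y n B (fun ω => q * x ω)

/-- The polynomial of degree less than `n` with the coefficients `u`. -/
noncomputable def polyOf {B : Type*} [CommRing B] {n : ℕ} (u : Fin n → B) : B[X] :=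
  ∑ t, C (u t) * X ^ (t : ℕ)

/-- A `p`-ary fast Fourier transform over `F[y]`: multiplication by a fixed polynomial modulo
`X ^ n - y ^ e`, where `n = p ^ a`, by splitting the modulus into the factors
`X ^ (n / p) - y ^ e'`. Only additions and shifts are needed before and after the `n`
multiplications in `F[y]`. -/
theorem computes_mul_mod {p : ℕ} (hp : p.Prime) (hpF : (p : F) ≠ 0) {y : A} {j c : ℕ}
    (hy : ∑ i ∈ range p, (y ^ p ^ j) ^ i = 0) (hc : CanMul F Ω y (p ^ (j + 1)) c) :
    ∀ a ≤ j, ∀ n, n = p ^ a → ∀ e, p ^ a ∣ e → ∀ Q : A[X],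
      (∀ t, Q.coeff t ∈ Algebra.adjoin F {y}) → ∀ (S : Set (Ω → F)) (u : Fin n → Ω → A),
      (∀ t, Known y (p ^ (j + 1)) S (u t)) →
      ∃ B, Computes S (p ^ a * c + a * (2 * p * p ^ a * p ^ (j + 1))) B ∧
        ∃ v : Fin n → Ω → A, (∀ t, Known y (p ^ (j + 1)) B (v t)) ∧
          ∀ ω, X ^ n - C (y ^ e) ∣ polyOf (fun t => v t ω) - polyOf (fun t => u t ω) * Q := by
  set L := p ^ (j + 1) with hL
  have hyL : y ^ L = 1 := by
    rw [hL, pow_succ, pow_mul]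
    exact pow_eq_one_of_geom_sum_eq_zero hy
  intro a
  induction a with
  | zero =>
    rintro - n hn e - Q hQ S u hu
    obtain rfl : n = 1 := by rw [hn, pow_zero]
    have hq : Q.eval (y ^ e) ∈ Algebra.adjoin F {y} := by
      rw [eval_eq_sum_range]
      exact sum_mem fun t _ => mul_mem (hQ t)
        (pow_mem (pow_mem (Algebra.self_mem_adjoin_singleton F y) _) _)
    obtain ⟨B, hB, hx⟩ := hc _ hq S (u 0) (hu 0)
    refine ⟨B, by simpa using hB, fun _ ω => Q.eval (y ^ e) * u 0 ω, fun _ => hx, fun ω => ?_⟩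
    have h1 := X_sub_C_dvd_sub_C_eval (p := Q) (a := y ^ e)
    rw [pow_one]
    have h2 : polyOf (fun _ : Fin 1 => Q.eval (y ^ e) * u 0 ω)
        - polyOf (fun t : Fin 1 => u t ω) * Q
        = -C (u 0 ω) * (Q - C (Q.eval (y ^ e))) := by
      simp [polyOf]
      ring
    rw [h2]
    exact h1.mul_left _
  | succ a ih =>
    rintro ha n hn e ⟨e', rfl⟩ Q hQ S u hu
    obtain ⟨n', hn', rfl⟩ : ∃ n', n' = p ^ a ∧ n = p * n' := ⟨p ^ a, rfl, by rw [hn, pow_succ']⟩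
    -- the exponents of the `p`-th roots of `y ^ (p ^ (a + 1) * e')`
    set g : Fin p → ℕ := fun i => i * p ^ j + p ^ a * e' with hg
    have hgd : ∀ i, p ^ a ∣ g i := fun i =>
      dvd_add ((pow_dvd_pow p (by omega)).mul_left _) (dvd_mul_right _ _)
    set π : F := (p : F)⁻¹ with hπ
    have hQ' : ∀ t, (C (algebraMap F A π) * Q).coeff t ∈ Algebra.adjoin F {y} := fun t => by
      rw [coeff_C_mul]
      exact mul_mem (Subalgebra.algebraMap_mem _ _) (hQ t)
    -- folding
    obtain ⟨B₁, hB₁, hfold⟩ := Computes.exists_forall (A := S)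
      (fun (it : Fin p × Fin n') B => Known y L B fun ω =>
        ∑ k : Fin p, (y ^ (g it.1 * k)) * u (finProdFinEquiv (k, it.2)) ω)
      (fun _ _ _ h h' => h'.mono (h.trans (subset_withConsts _))) (fun _ => p * L)
      (fun it => by
        have := Known.sum (S := S) univ (fun (k : Fin p) ω =>
          (y ^ (g it.1 * k)) * u (finProdFinEquiv (k, it.2)) ω)
          fun k _ => (hu _).pow_mul hyL _
        simpa using this)
    -- the `p` recursive multiplications
    obtain ⟨B₂, hB₂, hrec⟩ := Computes.exists_forall (A := B₁)
      (fun (i : Fin p) B => ∃ v : Fin n' → Ω → A, (∀ t, Known y L B (v t)) ∧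
        ∀ ω, X ^ n' - C (y ^ g i) ∣ polyOf (fun t => v t ω) -
          polyOf (fun t => ∑ k : Fin p, (y ^ (g i * k)) * u (finProdFinEquiv (k, t)) ω) *
            (C (algebraMap F A π) * Q))
      (fun _ _ _ h ⟨v, h1, h2⟩ => ⟨v, fun t => (h1 t).mono (h.trans (subset_withConsts _)), h2⟩)
      (fun _ => _)
      (fun i => ih (by omega) n' hn' (g i) (hgd i) _ hQ' B₁ _ fun t => hfold (i, t))
    choose v hv hdvd using hrec
    -- recombination
    obtain ⟨B₃, hB₃, hcomb⟩ := Computes.exists_forall (A := B₂)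
      (fun (kt : Fin p × Fin n') B => Known y L B fun ω =>
        ∑ i : Fin p, (y ^ (g i * (L - 1) * kt.1)) * v i kt.2 ω)
      (fun _ _ _ h h' => h'.mono (h.trans (subset_withConsts _))) (fun _ => p * L)
      (fun kt => by
        have := Known.sum (S := B₂) univ (fun (i : Fin p) ω =>
          (y ^ (g i * (L - 1) * kt.1)) * v i kt.2 ω)
          fun i _ => (hv i _).pow_mul hyL _
        simpa using this)
    refine ⟨B₃, ((hB₁.trans hB₂).trans hB₃).mono_cost ?_,
      fun s ω => ∑ i : Fin p, (y ^ (g i * (L - 1) * (finProdFinEquiv.symm s).1)) *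
        v i (finProdFinEquiv.symm s).2 ω, fun s => hcomb _, fun ω => ?_⟩
    · simp only [sum_const, card_univ, Fintype.card_prod, Fintype.card_fin, smul_eq_mul, hn']
      exact le_of_eq (by ring)
    have hp0 : 0 < p := hp.pos
    have hL0 : 0 < L := pow_pos hp0 _
    have hVW : ∀ i, y ^ (g i * (L - 1)) * y ^ g i = 1 := fun i => by
      rw [← pow_add, show g i * (L - 1) + g i = L * g i by
        obtain ⟨l, hl⟩ : ∃ l, L = l + 1 := ⟨L - 1, by omega⟩
        rw [hl, Nat.add_sub_cancel]; ring, pow_mul, hyL, one_pow]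
    have hW : ∀ i, (y ^ g i) ^ p = y ^ (p ^ (a + 1) * e') := fun i => by
      rw [← pow_mul, show g i * p = L * i + p ^ (a + 1) * e' by simp only [hg, hL]; ring, pow_add,
        pow_mul, hyL, one_pow, one_mul]
    have hV : ∀ k, 0 < k → k < p → ∑ i : Fin p, (y ^ (g i * (L - 1))) ^ k = 0 := by
      intro k hk hkp
      have h1 : ¬ p ∣ (L - 1) * k := by
        rw [hp.dvd_mul]
        rintro (h | h)
        · have h2 : p ∣ L := by rw [hL, pow_succ]; exact dvd_mul_left _ _
          have h3 := (Nat.dvd_sub_iff_right (by omega) h2).1 h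
          exact hp.one_lt.ne' (Nat.dvd_one.1 h3)
        · exact absurd (Nat.le_of_dvd hk h) (by omega)
      have h2 := geom_sum_pow_eq_zero hp hy h1
      rw [← Fin.sum_univ_eq_sum_range] at h2
      have h3 : ∀ i : Fin p, (y ^ (g i * (L - 1))) ^ k
          = y ^ (p ^ a * e' * (L - 1) * k) * ((y ^ p ^ j) ^ ((L - 1) * k)) ^ (i : ℕ) := fun i => by
        simp only [← pow_mul, ← pow_add, hg]
        congr 1
        ring
      rw [sum_congr rfl fun i _ => h3 i, ← mul_sum, h2, mul_zero]
    have hcrt := sub_dvd_crt (B := A[X]) (p := p) hp0 (T := X ^ n')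
      (w := C (y ^ (p ^ (a + 1) * e'))) (π := C (algebraMap F A π))
      (P := polyOf fun s => u s ω) (Q := Q) (W := fun i => C (y ^ g i))
      (V := fun i => C (y ^ (g i * (L - 1)))) (E := fun i => polyOf fun t => v i t ω)
      (fun i => by rw [← C_mul, hVW, C_1]) (fun i => by rw [← C_pow, hW])
      (fun k hk hkp => by simp only [← C_pow, ← map_sum]; rw [hV k hk hkp, C_0])
      (by rw [← C_eq_natCast, ← map_natCast (algebraMap F A), ← C_mul, ← map_mul, hπ,
            mul_inv_cancel₀ hpF, map_one, C_1])
      (fun i => by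
        have h1 := sub_dvd_fold (T := (X : A[X]) ^ n') (W := C (y ^ g i))
          (fun k : Fin p => polyOf fun t : Fin n' => u (finProdFinEquiv (k, t)) ω)
        have h2 : ∑ k : Fin p, polyOf (fun t : Fin n' => u (finProdFinEquiv (k, t)) ω) *
            (X ^ n') ^ (k : ℕ) = polyOf fun s => u s ω := by
          simp only [polyOf]
          rw [← finProdFinEquiv.sum_comp, Fintype.sum_prod_type]
          refine sum_congr rfl fun k _ => ?_
          rw [sum_mul]
          refine sum_congr rfl fun t _ => ?_
          rw [finProdFinEquiv_apply_val, pow_add, pow_mul]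
          ring
        have h3 : ∑ k : Fin p, polyOf (fun t : Fin n' => u (finProdFinEquiv (k, t)) ω) *
            C (y ^ g i) ^ (k : ℕ)
            = polyOf fun t => ∑ k : Fin p, (y ^ (g i * k)) * u (finProdFinEquiv (k, t)) ω := by
          simp only [polyOf, sum_mul, map_sum]
          rw [sum_comm]
          refine sum_congr rfl fun t _ => sum_congr rfl fun k _ => ?_
          rw [← C_pow, ← pow_mul, C_mul]
          ring
        rw [h2, h3] at h1
        have h4 := (hdvd i ω).sub (h1.mul_right (C (algebraMap F A π) * Q))
        convert h4 using 1
        ring)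
    rw [← pow_mul, mul_comm n' p] at hcrt
    convert hcrt using 2
    simp only [polyOf]
    rw [← finProdFinEquiv.sum_comp, Fintype.sum_prod_type]
    simp only [Equiv.symm_apply_apply, sum_mul, mul_sum, map_sum, finProdFinEquiv_apply_val]
    rw [sum_comm, sum_congr rfl fun t _ => sum_comm, sum_comm]
    refine sum_congr rfl fun i _ => sum_congr rfl fun t _ => sum_congr rfl fun k _ => ?_
    rw [C_mul, pow_mul y, C_pow, mul_pow, pow_add, pow_mul X]
    ring

theorem exists_expansion (x : A) {m : ℕ} (hm : 0 < m) {q : A} (hq : q ∈ Algebra.adjoin F {x}) :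
    ∃ Q : Fin m → A, (∀ t, Q t ∈ Algebra.adjoin F {x ^ m}) ∧ q = ∑ t, Q t * x ^ (t : ℕ) := by
  rw [Algebra.adjoin_singleton_eq_range_aeval] at hq
  obtain ⟨f, rfl⟩ := hq
  induction f using Polynomial.induction_on' with
  | add f g hf hg =>
    obtain ⟨Q, hQ, h1⟩ := hf
    obtain ⟨Q', hQ', h2⟩ := hg
    refine ⟨fun t => Q t + Q' t, fun t => add_mem (hQ t) (hQ' t), ?_⟩
    simp only [add_mul, sum_add_distrib, ← h1, ← h2]
    exact map_add _ _ _
  | monomial k a =>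
    have hk : k % m < m := Nat.mod_lt _ hm
    refine ⟨fun t => if t = ⟨k % m, hk⟩ then a • (x ^ m) ^ (k / m) else 0, fun t => ?_, ?_⟩
    · dsimp only
      split_ifs
      · exact Subalgebra.smul_mem _ (pow_mem (Algebra.self_mem_adjoin_singleton F _) _) _
      · exact zero_mem _
    · simp only [ite_mul, zero_mul, sum_ite_eq', mem_univ, if_true, smul_mul_assoc]
      rw [← pow_mul, ← pow_add, Nat.div_add_mod]
      simp [aeval_monomial, Algebra.smul_def]

/-- In low degree the product is found by multiplying with a matrix. -/
theorem canMul_naive {y : A} {n : ℕ} (hn : 0 < n) (hy : y ^ n = 1) :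
    CanMul F Ω y n (n * (2 * n)) := by
  intro q hq S x hx
  obtain ⟨c, hc, hx⟩ := hx
  have hrep : ∀ a ∈ Algebra.adjoin F {y}, ∃ r : Fin n → F, a = ∑ t, r t • y ^ (t : ℕ) := by
    intro a ha
    obtain ⟨Q, hQ, rfl⟩ := exists_expansion y hn ha
    rw [hy, Algebra.adjoin_singleton_one] at hQ
    choose r hr using fun t => Algebra.mem_bot.1 (hQ t)
    exact ⟨r, sum_congr rfl fun t _ => by rw [← hr, Algebra.smul_def]⟩
  choose r hr using fun l : Fin n => hrep (q * y ^ (l : ℕ))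
    (mul_mem hq (pow_mem (Algebra.self_mem_adjoin_singleton F y) _))
  have := Computes.range (A := S) (fun (t : Fin n) ω => ∑ l, r l t * c l ω) fun t => by
    have := Computes.linear_combination (A := S) univ (fun l => r l t) c fun l _ => hc l
    rwa [card_univ, Fintype.card_fin] at this
  rw [Fintype.card_fin] at this
  refine ⟨_, this, _, fun i => Or.inl ⟨i, rfl⟩, fun ω => ?_⟩
  simp only [hx, mul_sum, mul_smul_comm, hr, sum_smul, smul_sum]
  rw [sum_comm]
  simp only [smul_smul, mul_comm]

/-- The reduction step of fast multiplication: an element `∑ t < m, a t * x ^ t` with `a t` in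
`F[y]`, `y = x ^ m`, is read as the value at `x` of a polynomial of degree less than `m`. The
product of two such polynomials has degree less than `2 * m`, so it is determined by its residues
modulo `X ^ m - 1` and `X ^ m - ζ`, for which `F[y]` has enough roots of unity. -/
theorem canMul_step [Nontrivial A] {p : ℕ} (hp : p.Prime) (hpF : (p : F) ≠ 0) {x : A} {a j c : ℕ}
    (haj : a ≤ j) (hx : ∑ i ∈ range p, (x ^ p ^ (a + j)) ^ i = 0)
    (hc : CanMul F Ω (x ^ p ^ a) (p ^ (j + 1)) c) :
    CanMul F Ω x (p ^ (a + j + 1))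
      (2 * (p ^ a * c + a * (2 * p * p ^ a * p ^ (j + 1))) + p ^ a * (3 * p ^ (j + 1))) := by
  obtain ⟨m, hm⟩ : ∃ m, m = p ^ a := ⟨_, rfl⟩
  have hm0 : 0 < m := hm ▸ pow_pos hp.pos _
  rw [← hm] at hc ⊢
  set y := x ^ m with hyx
  set L := p ^ (j + 1) with hL
  have hy : ∑ i ∈ range p, (y ^ p ^ j) ^ i = 0 := by
    rwa [hyx, ← pow_mul, hm, ← pow_add]
  set ζ := y ^ p ^ j with hζ
  have hyL : y ^ L = 1 := by
    rw [hL, pow_succ, pow_mul]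
    exact pow_eq_one_of_geom_sum_eq_zero hy
  have hLm : p ^ (a + j + 1) = L * m := by rw [hL, hm]; ring
  intro q hq S z hz
  rw [hLm] at hz ⊢
  -- the fixed factor, as a polynomial divided by `1 - ζ`
  obtain ⟨q', hq', rfl⟩ := exists_expansion x hm0 hq
  rw [← hyx] at hq'
  have hymem : ∀ e, y ^ e ∈ Algebra.adjoin F {y} := fun e =>
    pow_mem (Algebra.self_mem_adjoin_singleton F y) e
  obtain ⟨η, hη, hη1⟩ : ∃ η ∈ Algebra.adjoin F {y}, (1 - ζ) * η = 1 := by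
    refine ⟨(-(p : F)⁻¹) • ∑ i ∈ range p, (i : A) * ζ ^ i, Subalgebra.smul_mem _
      (sum_mem fun i _ => mul_mem (natCast_mem _ i) (pow_mem (hymem _) _)) _, ?_⟩
    rw [mul_smul_comm, one_sub_mul_sum hy, neg_smul_neg, ← map_natCast (algebraMap F A) p,
      Algebra.smul_def, ← map_mul, inv_mul_cancel₀ hpF, map_one]
  set Q : A[X] := C η * polyOf q' with hQ
  have hQmem : ∀ t, Q.coeff t ∈ Algebra.adjoin F {y} := fun t => by
    rw [hQ, coeff_C_mul, polyOf, finsetSum_coeff]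
    refine mul_mem hη (sum_mem fun i _ => ?_)
    rw [coeff_C_mul, coeff_X_pow]
    split_ifs
    · simpa using hq' i
    · simp
  -- the other factor, as a polynomial
  obtain ⟨c', hc', hz⟩ := hz
  set u : Fin m → Ω → A := fun t ω => ∑ i : Fin L, c' (finProdFinEquiv (i, t)) ω • y ^ (i : ℕ)
    with hu
  have huK : ∀ t, Known y L S (u t) := fun t => ⟨fun i => c' (finProdFinEquiv (i, t)),
    fun i => hc' _, fun ω => rfl⟩
  have hzu : ∀ ω, z ω = (polyOf fun t => u t ω).eval x := fun ω => by
    simp only [polyOf, eval_finsetSum, eval_mul, eval_C, eval_pow, eval_X, hu, sum_mul]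
    rw [hz, ← finProdFinEquiv.sum_comp, Fintype.sum_prod_type, sum_comm]
    refine sum_congr rfl fun t _ => sum_congr rfl fun i _ => ?_
    rw [finProdFinEquiv_apply_val, hyx, ← pow_mul, smul_mul_assoc, ← pow_add, add_comm]
  obtain ⟨B₁, hB₁, v, hv, hdvd⟩ := computes_mul_mod hp hpF hy hc a haj m hm 0 (dvd_zero _) Q hQmem
    S u huK
  obtain ⟨B₂, hB₂, v', hv', hdvd'⟩ := computes_mul_mod hp hpF hy hc a haj m hm (p ^ j)
    (pow_dvd_pow p haj) Q hQmem S u huK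
  have hv := fun t => (hv t).mono
    ((Set.subset_union_left (t := B₂)).trans (subset_withConsts _))
  have hv' := fun t => (hv' t).mono
    ((Set.subset_union_right (s := B₁)).trans (subset_withConsts _))
  obtain ⟨B₃, hB₃, hout⟩ := Computes.exists_forall (A := B₁ ∪ B₂)
    (fun (t : Fin m) B => Known y L B fun ω =>
      (v' t ω - y ^ p ^ j * v t ω) + y ^ 1 * (v t ω - v' t ω))
    (fun _ _ _ h h' => h'.mono (h.trans (subset_withConsts _))) (fun _ => 3 * L)
    (fun t => by
      obtain ⟨D, hD, h1⟩ := (hv' t).sub ((hv t).pow_mul hyL (p ^ j))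
      obtain ⟨D', hD', h2⟩ := (hv t).sub (hv' t)
      obtain ⟨D'', hD'', h3⟩ := (h1.mono
        ((Set.subset_union_left (t := D')).trans (subset_withConsts _))).add ((h2.mono
        ((Set.subset_union_right (s := D)).trans (subset_withConsts _))).pow_mul hyL 1)
      exact ⟨D'', ((hD.union hD').trans hD'').mono_cost (by omega), h3⟩)
  rw [sum_const, card_univ, Fintype.card_fin, smul_eq_mul] at hB₃
  refine ⟨B₃, ((hB₁.union hB₂).trans hB₃).mono_cost (by rw [hm]; exact le_of_eq (by ring)), ?_⟩
  choose d hd hd' using hout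
  refine ⟨fun s => d (finProdFinEquiv.symm s).2 (finProdFinEquiv.symm s).1, fun s => hd _ _,
    fun ω => ?_⟩
  -- the two residues determine the product
  have hprod : polyOf (fun t => u t ω) * polyOf q'
      = (polyOf (fun t => v' t ω) - C ζ * polyOf (fun t => v t ω))
        + X ^ m * (polyOf (fun t => v t ω) - polyOf (fun t => v' t ω)) := by
    have hdeg : ∀ r : Fin m → A, (polyOf r).natDegree ≤ m - 1 := fun r =>
      natDegree_sum_le_of_forall_le _ _ fun t _ =>
        (natDegree_C_mul_X_pow_le _ _).trans (by have := t.2; omega)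
    rw [← sub_eq_zero, ← neg_eq_zero]
    by_contra hne
    refine (((monic_X_pow_sub_C (1 : A) hm0.ne').mul
      (monic_X_pow_sub_C ζ hm0.ne')).not_dvd_of_natDegree_lt hne ?_) ?_
    · rw [(monic_X_pow_sub_C (1 : A) hm0.ne').natDegree_mul (monic_X_pow_sub_C ζ hm0.ne'),
        natDegree_X_pow_sub_C, natDegree_X_pow_sub_C, natDegree_neg]
      refine lt_of_le_of_lt (b := m + (m - 1)) ?_ (by omega)
      refine natDegree_sub_le_of_le (natDegree_mul_le_of_le ((hdeg _).trans (by omega)) (hdeg _))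
        (natDegree_add_le_of_le (m := m + (m - 1)) ?_ ?_ |>.trans (max_self _).le)
        |>.trans (max_self _).le
      · refine natDegree_sub_le_of_le ((hdeg _).trans (by omega)) ((natDegree_C_mul_le _ _).trans
          ((hdeg _).trans (by omega))) |>.trans (max_self _).le
      · exact natDegree_mul_le_of_le (natDegree_X_pow_le m)
          (natDegree_sub_le_of_le (hdeg _) (hdeg _) |>.trans (max_self _).le)
    · obtain ⟨g, hg⟩ := hdvd ω
      obtain ⟨g', hg'⟩ := hdvd' ω
      rw [pow_zero] at hg
      rw [← hζ] at hg'
      refine ⟨g - g', ?_⟩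
      have hη2 : (1 - C ζ) * C η = 1 := by rw [← C_1, ← C_sub, ← C_mul, hη1]
      rw [hQ] at hg hg'
      rw [C_1] at hg ⊢
      linear_combination (X ^ m - C ζ) * hg - (X ^ m - 1) * hg'
        + polyOf (fun t => u t ω) * polyOf q' * hη2
  have h1 : (∑ t, q' t * x ^ (t : ℕ)) = (polyOf q').eval x := by
    simp [polyOf, eval_finsetSum]
  simp only [h1, hzu]
  rw [mul_comm, ← eval_mul, hprod]
  rw [← finProdFinEquiv.sum_comp, Fintype.sum_prod_type, sum_comm]
  simp only [Equiv.symm_apply_apply, finProdFinEquiv_apply_val]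
  have h2 : ∀ t : Fin m, ∑ i : Fin L, d t i ω • x ^ ((t : ℕ) + m * i)
      = x ^ (t : ℕ) * ((v' t ω - y ^ p ^ j * v t ω) + y ^ 1 * (v t ω - v' t ω)) := fun t => by
    have h3 := hd' t ω
    dsimp only at h3
    rw [h3, mul_sum]
    refine sum_congr rfl fun i _ => ?_
    rw [hyx, ← pow_mul, mul_smul_comm, pow_add]
  rw [sum_congr rfl fun t _ => h2 t]
  simp only [polyOf, eval_add, eval_sub, eval_mul, eval_finsetSum, eval_C, eval_pow, eval_X,
    mul_sum, ← sum_sub_distrib, ← sum_add_distrib, ← hyx, ← hζ]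
  refine sum_congr rfl fun t _ => ?_
  ring

/-- Halving the exponent `J` repeatedly: the cost per coefficient doubles in each of the `s` rounds
and gains an amount proportional to `2 ^ s`. -/
theorem canMul_fast [Nontrivial A] {p : ℕ} (hp : p.Prime) (hp3 : p ≤ 3) (hpF : (p : F) ≠ 0)
    (s : ℕ) :
    ∀ J ≤ 2 ^ s, ∀ x : A, ∑ i ∈ range p, (x ^ p ^ J) ^ i = 0 →
      CanMul F Ω x (p ^ (J + 1)) (p ^ J * (2 ^ s * (54 + 45 * s))) := by
  have hmono : ∀ {y : A} {n c c' : ℕ}, CanMul F Ω y n c → c ≤ c' → CanMul F Ω y n c' :=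
    fun h hc q hq S x hx =>
      let ⟨B, hB, hx'⟩ := h q hq S x hx
      ⟨B, hB.mono_cost hc, hx'⟩
  have hbase : ∀ J ≤ 1, ∀ x : A, ∑ i ∈ range p, (x ^ p ^ J) ^ i = 0 →
      CanMul F Ω x (p ^ (J + 1)) (p ^ J * 54) := by
    intro J hJ x hx
    refine hmono (canMul_naive (pow_pos hp.pos _) ?_) ?_
    · rw [pow_succ, pow_mul]
      exact pow_eq_one_of_geom_sum_eq_zero hx
    · have h1 : p ^ J * p ^ 2 ≤ 3 ^ 1 * 3 ^ 2 := by
        rw [← pow_add, ← pow_add]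
        exact (Nat.pow_le_pow_left hp3 _).trans (Nat.pow_le_pow_right (by norm_num) (by omega))
      calc p ^ (J + 1) * (2 * p ^ (J + 1)) = p ^ J * (2 * (p ^ J * p ^ 2)) := by ring
        _ ≤ p ^ J * 54 := Nat.mul_le_mul_left _ (by omega)
  induction s with
  | zero => simpa using hbase
  | succ s ih =>
    intro J hJ x hx
    rcases Nat.lt_or_ge 1 J with hJ1 | hJ1
    · obtain ⟨a, j, rfl, haj, hj⟩ : ∃ a j, J = a + j ∧ a ≤ j ∧ j ≤ 2 ^ s :=
        ⟨J / 2, J - J / 2, by omega, by omega, by rw [pow_succ] at hJ; omega⟩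
      have h1 := canMul_step hp hpF haj hx
        (ih j hj (x ^ p ^ a) (by rwa [← pow_mul, ← pow_add]))
      refine hmono h1 ?_
      have h2 : p * p ≤ 9 := Nat.mul_le_mul hp3 hp3
      have h3 : a * (p * p) ≤ 2 ^ s * 9 := Nat.mul_le_mul (haj.trans hj) h2
      have h4 : 0 < 2 ^ s := by positivity
      calc 2 * (p ^ a * (p ^ j * (2 ^ s * (54 + 45 * s))) + a * (2 * p * p ^ a * p ^ (j + 1)))
              + p ^ a * (3 * p ^ (j + 1))
          = p ^ (a + j) * (2 * (2 ^ s * (54 + 45 * s)) + 4 * (a * (p * p)) + 3 * p) := by ring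
        _ ≤ p ^ (a + j) * (2 ^ (s + 1) * (54 + 45 * (s + 1))) := by
          refine Nat.mul_le_mul_left _ ?_
          rw [pow_succ]
          nlinarith
    · refine hmono (hbase J hJ1 x hx) (Nat.mul_le_mul_left _ ?_)
      have h4 : 1 ≤ 2 ^ (s + 1) := Nat.one_le_two_pow
      nlinarith

/-! ### Multiplication by a fixed polynomial -/

/-- The coefficient functions of a polynomial that depends on `ω`. -/
def coeffs (g : Ω → F[X]) : Set (Ω → F) :=
  Set.range fun (i : ℕ) ω => (g ω).coeff i

theorem coeffs_subset_withConsts {g : Ω → F[X]} {n : ℕ} {S : Set (Ω → F)}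
    (hg : ∀ ω, (g ω).degree < n) (h : ∀ i < n, (fun ω => (g ω).coeff i) ∈ withConsts S) :
    coeffs g ⊆ withConsts S := by
  rintro _ ⟨i, rfl⟩
  rcases lt_or_ge i n with hi | hi
  · exact h i hi
  · refine Or.inr ⟨0, funext fun ω => coeff_eq_zero_of_degree_lt ((hg ω).trans_le ?_)⟩
    exact_mod_cast hi

/-- The cost per coefficient of multiplication by a fixed polynomial of degree at most `2 ^ k`; of
the order of `k * log k`. -/
def mulCost (k : ℕ) : ℕ :=
  2 ^ Nat.clog 2 (k + 1) * (342 + 270 * Nat.clog 2 (k + 1))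

theorem coeff_polyOf {B : Type*} [CommRing B] {n : ℕ} (u : Fin n → B) (i : ℕ) :
    (polyOf u).coeff i = if h : i < n then u ⟨i, h⟩ else 0 := by
  simp only [polyOf, finsetSum_coeff, coeff_C_mul, coeff_X_pow]
  split_ifs with h
  · rw [sum_eq_single ⟨i, h⟩ (fun t _ ht => ?_) (by simp)]
    · simp
    · rw [if_neg fun h' => ht (Fin.ext h'.symm), mul_zero]
  · exact sum_eq_zero fun t _ => by rw [if_neg (by have := t.2; omega), mul_zero]

theorem polyOf_coeff {B : Type*} [CommRing B] {n : ℕ} {g : B[X]} (hg : g.degree < n) :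
    polyOf (fun i : Fin n => g.coeff i) = g := by
  ext i
  rw [coeff_polyOf]
  split_ifs with h
  · rfl
  · exact (coeff_eq_zero_of_degree_lt (hg.trans_le (by exact_mod_cast not_lt.1 h))).symm

/-- Multiplication by a fixed polynomial over any field. One of the primes `2` and `3` is
invertible in `F`; for this `p` the product is computed in the algebra `F[X] / Φ` with
`Φ = 1 + X ^ r + ... + X ^ ((p - 1) * r)`, where `r` is a power of `p` above the degree of the
product. -/
theorem computes_fixed_mul (h : F[X]) {k : ℕ} (hh : h.natDegree ≤ 2 ^ k) (g : Ω → F[X])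
    (hg : ∀ ω, (g ω).degree < (2 ^ k : ℕ)) :
    Computes (coeffs g) (2 ^ k * mulCost k) (coeffs fun ω => g ω * h) := by
  obtain ⟨p, hp, hp3, hpF⟩ : ∃ p : ℕ, p.Prime ∧ p ≤ 3 ∧ (p : F) ≠ 0 := by
    by_cases h2 : ((2 : ℕ) : F) = 0
    · refine ⟨3, Nat.prime_three, le_rfl, fun h3 => one_ne_zero (α := F) ?_⟩
      push_cast at h2 h3
      linear_combination h3 - h2
    · exact ⟨2, Nat.prime_two, by norm_num, h2⟩
  set J := Nat.clog p (2 ^ (k + 1)) with hJ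
  have hJ1 : 2 ^ (k + 1) ≤ p ^ J := Nat.le_pow_clog hp.one_lt _
  have hJ2 : p ^ J ≤ 3 * 2 ^ (k + 1) := by
    have h1 : J ≠ 0 := (Nat.clog_pos hp.one_lt (by
      calc 2 ≤ 2 ^ 1 := by norm_num
        _ ≤ 2 ^ (k + 1) := Nat.pow_le_pow_right (by norm_num) (by omega))).ne'
    obtain ⟨J', hJ'⟩ := Nat.exists_eq_succ_of_ne_zero h1
    have h2 : p ^ J' < 2 ^ (k + 1) := by
      by_contra hcon
      have := (Nat.clog_le_iff_le_pow hp.one_lt).2 (not_lt.1 hcon)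
      omega
    rw [hJ', Nat.succ_eq_add_one, pow_succ, mul_comm]
    exact Nat.mul_le_mul hp3 h2.le
  have hJ3 : J ≤ 2 ^ Nat.clog 2 (k + 1) :=
    ((Nat.clog_le_iff_le_pow hp.one_lt).2 (Nat.pow_le_pow_left hp.two_le _)).trans
      (Nat.le_pow_clog (by norm_num) _)
  set s := Nat.clog 2 (k + 1) with hs
  -- the ring `F[X] / Φ`, in which `Φ` has a root of order `p ^ (J + 1)`
  set r := p ^ J with hr
  have hr0 : 0 < r := pow_pos hp.pos _
  set Φ : F[X] := ∑ i ∈ range p, (X ^ r) ^ i with hΦ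
  have hΦ0 : Φ.Monic := (monic_X_pow r).geom_sum (by rwa [natDegree_X_pow]) hp.ne_zero
  have hΦ1 : Φ.natDegree = (p - 1) * r := by
    have h1 : Φ * (X ^ r - 1) = X ^ (r * p) - 1 := by rw [hΦ, geom_sum_mul, ← pow_mul]
    have h2 := congrArg natDegree h1
    rw [← C_1, hΦ0.natDegree_mul (monic_X_pow_sub_C 1 hr0.ne'), natDegree_X_pow_sub_C,
      natDegree_X_pow_sub_C, mul_comm] at h2
    rw [Nat.sub_mul, one_mul]
    omega
  have hrΦ : r ≤ Φ.natDegree := by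
    rw [hΦ1]
    exact Nat.le_mul_of_pos_left _ (by have := hp.two_le; omega)
  have hΦ2 : Φ.degree ≠ 0 := by
    rw [degree_eq_natDegree hΦ0.ne_zero]
    exact_mod_cast (hr0.trans_le hrΦ).ne'
  have : Nontrivial (AdjoinRoot Φ) := AdjoinRoot.nontrivial Φ hΦ2
  have hroot : ∑ i ∈ range p, (AdjoinRoot.root Φ ^ p ^ J) ^ i = 0 := by
    have h1 : AdjoinRoot.mk Φ (∑ i ∈ range p, (X ^ r) ^ i) = 0 := AdjoinRoot.mk_self
    simpa [AdjoinRoot.mk_X] using h1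
  have hmk : ∀ u : Fin (p * r) → F,
      AdjoinRoot.mk Φ (polyOf u) = ∑ i, u i • AdjoinRoot.root Φ ^ (i : ℕ) := fun u => by
    simp [polyOf, AdjoinRoot.mk_X, AdjoinRoot.mk_C, Algebra.smul_def]
  have hgL : ∀ ω, (g ω).degree < (p * r : ℕ) := fun ω => (hg ω).trans_le (by
    have h1 : r ≤ p * r := Nat.le_mul_of_pos_left r hp.pos
    have h2 : 2 ^ k ≤ 2 ^ (k + 1) := Nat.pow_le_pow_right (by norm_num) (by omega)
    exact_mod_cast h2.trans (hJ1.trans h1))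
  have hcm := canMul_fast (Ω := Ω) hp hp3 hpF s J hJ3 (AdjoinRoot.root Φ) hroot
  rw [show p ^ (J + 1) = p * r by rw [pow_succ']] at hcm
  obtain ⟨B, hB, c, hc, hprod⟩ := hcm
    (AdjoinRoot.mk Φ h) (by
      rw [Algebra.adjoin_singleton_eq_range_aeval]
      exact ⟨h, AdjoinRoot.aeval_eq h⟩) (coeffs g) (fun ω => AdjoinRoot.mk Φ (g ω))
    ⟨fun i ω => (g ω).coeff i, fun i => Or.inl ⟨i, rfl⟩, fun ω => by
      rw [← hmk, polyOf_coeff (hgL ω)]⟩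
  -- reduction of the redundant representation: the last block is subtracted from all blocks
  set top : Fin p := ⟨p - 1, Nat.sub_lt hp.pos one_pos⟩ with htop
  set d : Fin (p * r) → Ω → F := fun i =>
    c i - c (finProdFinEquiv (top, (finProdFinEquiv.symm i).2)) with hd
  have hgh : ∀ ω, g ω * h = polyOf fun i => d i ω := by
    intro ω
    have h1 : Φ ∣ polyOf (fun i => c i ω) - polyOf fun i => d i ω := by
      refine ⟨polyOf fun t : Fin r => c (finProdFinEquiv (top, t)) ω, ?_⟩
      rw [hΦ, ← Fin.sum_univ_eq_sum_range (fun i => ((X : F[X]) ^ r) ^ i)]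
      simp only [polyOf, hd, ← sum_sub_distrib, sum_mul_sum]
      rw [← finProdFinEquiv.sum_comp, Fintype.sum_prod_type]
      refine sum_congr rfl fun l _ => sum_congr rfl fun t _ => ?_
      rw [← sub_mul, ← C_sub, Equiv.symm_apply_apply, finProdFinEquiv_apply_val, pow_add, pow_mul]
      simp only [Pi.sub_apply, sub_sub_cancel]
      ring
    have h2 : Φ ∣ g ω * h - polyOf fun i => d i ω := by
      refine AdjoinRoot.mk_eq_mk.1 ?_
      rw [← AdjoinRoot.mk_eq_mk.2 h1, hmk, ← hprod ω, map_mul, mul_comm]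
    rw [← sub_eq_zero]
    by_contra hne
    refine hΦ0.not_dvd_of_degree_lt hne ?_ h2
    rw [degree_eq_natDegree hΦ0.ne_zero]
    refine (degree_sub_le _ _).trans_lt (max_lt ?_ ?_)
    · rcases eq_or_ne (g ω * h) 0 with h0 | h0
      · rw [h0, degree_zero]; exact WithBot.bot_lt_coe _
      · rw [degree_eq_natDegree h0]
        have h3 : (g ω).natDegree < 2 ^ k := (natDegree_lt_iff_degree_lt
          (left_ne_zero_of_mul h0)).2 (hg ω)
        have h4 := natDegree_mul_le (p := g ω) (q := h)
        rw [pow_succ] at hJ1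
        exact_mod_cast (show _ < Φ.natDegree by omega)
    · rw [degree_lt_iff_coeff_zero]
      intro i hi
      rw [coeff_polyOf]
      split_ifs with h3
      · have h4 : (finProdFinEquiv.symm (⟨i, h3⟩ : Fin (p * r))).1 = top := by
          apply Fin.ext
          have h5 : (p - 1) * r ≤ i := by rw [← hΦ1]; exact_mod_cast hi
          have h6 : p - 1 ≤ i / r := (Nat.le_div_iff_mul_le hr0).2 h5
          have h7 : i / r < p := Nat.div_lt_of_lt_mul (by rwa [mul_comm] at h3)
          rw [finProdFinEquiv_symm_apply]
          simp only [Fin.coe_divNat, htop]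
          omega
        simp only [hd, ← h4, Prod.mk.eta, Equiv.apply_symm_apply, sub_self, Pi.zero_apply]
      · rfl
  have h1 := Computes.range (A := B) d fun i => Computes.sub (hc _) (hc _)
  rw [Fintype.card_fin, mul_one] at h1
  refine ((hB.trans h1).mono_cost ?_).mono_target ?_
  · calc p ^ J * (2 ^ s * (54 + 45 * s)) + p * r ≤ r * (2 ^ s * (54 + 45 * s) + 3) := by
          rw [← hr]; nlinarith
      _ ≤ (3 * 2 ^ (k + 1)) * (2 ^ s * (54 + 45 * s) + 3 * 2 ^ s) :=
          Nat.mul_le_mul hJ2 (Nat.add_le_add_left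
            (Nat.le_mul_of_pos_right 3 (by positivity)) _)
      _ = 2 ^ k * mulCost k := by rw [mulCost, ← hs]; ring
  · rintro _ ⟨i, rfl⟩
    dsimp only
    rcases lt_or_ge i (p * r) with hi | hi
    · refine Or.inl ⟨⟨i, hi⟩, funext fun ω => ?_⟩
      rw [hgh, coeff_polyOf, dif_pos hi]
    · refine Or.inr ⟨0, funext fun ω => ?_⟩
      rw [hgh, coeff_polyOf, dif_neg (not_lt.2 hi)]

end FastDecoding

/-! ### Fast interpolation -/

namespace FastDecoding

open Polynomial

variable {F : Type u} [Field F] {Ω : Type v}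

theorem mulCost_mono : Monotone mulCost := by
  intro k l h
  have h1 : Nat.clog 2 (k + 1) ≤ Nat.clog 2 (l + 1) := Nat.clog_mono_right 2 (by omega)
  exact Nat.mul_le_mul (Nat.pow_le_pow_right (by norm_num) h1) (by omega)

theorem computes_add {A : Set (Ω → F)} {g g' : Ω → F[X]} {n : ℕ} (hg : ∀ ω, (g ω).degree < n)
    (hg' : ∀ ω, (g' ω).degree < n) (h : coeffs g ⊆ withConsts A) (h' : coeffs g' ⊆ withConsts A) :
    Computes A n (coeffs fun ω => g ω + g' ω) := by
  have := Computes.range (A := A)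
    (fun (i : Fin n) => (fun ω => (g ω).coeff i) + fun ω => (g' ω).coeff i)
    fun i => Computes.add (h ⟨i, rfl⟩) (h' ⟨i, rfl⟩)
  rw [Fintype.card_fin, mul_one] at this
  refine this.mono_target (coeffs_subset_withConsts
    (fun ω => (degree_add_le _ _).trans_lt (max_lt (hg ω) (hg' ω)))
    fun i hi => Or.inl ⟨⟨i, hi⟩, ?_⟩)
  funext ω
  simp

theorem computes_sub {A : Set (Ω → F)} {g g' r : Ω → F[X]} {n : ℕ} (hr : ∀ ω, (r ω).degree < n)
    (hrg : ∀ ω, r ω = g ω - g' ω) (h : coeffs g ⊆ withConsts A) (h' : coeffs g' ⊆ withConsts A) :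
    Computes A n (coeffs r) := by
  have := Computes.range (A := A)
    (fun (i : Fin n) => (fun ω => (g ω).coeff i) - fun ω => (g' ω).coeff i)
    fun i => Computes.sub (h ⟨i, rfl⟩) (h' ⟨i, rfl⟩)
  rw [Fintype.card_fin, mul_one] at this
  refine this.mono_target (coeffs_subset_withConsts hr fun i hi => Or.inl ⟨⟨i, hi⟩, ?_⟩)
  funext ω
  simp [hrg]

theorem degree_mul_lt_add {f g : F[X]} {a b : ℕ} (hf : f.degree < a) (hg : g.natDegree ≤ b) :
    (f * g).degree < (a + b : ℕ) := by
  rcases eq_or_ne f 0 with rfl | hf0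
  · rw [zero_mul, degree_zero]
    exact WithBot.bot_lt_coe _
  · have h1 := (natDegree_lt_iff_degree_lt hf0).2 hf
    have h2 := natDegree_mul_le (p := f) (q := g)
    exact degree_le_natDegree.trans_lt (by exact_mod_cast (show (f * g).natDegree < a + b by omega))

theorem monic_list_prod {l : List F[X]} (hl : ∀ m ∈ l, m.Monic) :
    l.prod.Monic ∧ l.prod.natDegree = (l.map natDegree).sum := by
  induction l with
  | nil => simp
  | cons m l ih =>
    obtain ⟨h1, h2⟩ := ih fun m hm => hl m (List.mem_cons_of_mem _ hm)
    have hm := hl m List.mem_cons_self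
    rw [List.prod_cons, List.map_cons, List.sum_cons, hm.natDegree_mul h1, h2]
    exact ⟨hm.mul h1, rfl⟩

/-- The numerator of `∑ i ∈ s, a i / (X - x i)` over the common denominator `∏ i ∈ s, (X - x i)`. -/
noncomputable def numerator {κ : Type*} [DecidableEq κ] (x a : κ → F) (s : Finset κ) : F[X] :=
  ∑ i ∈ s, C (a i) * ∏ j ∈ s.erase i, (X - C (x j))

theorem degree_numerator_lt {κ : Type*} [DecidableEq κ] (x a : κ → F) (s : Finset κ) :
    (numerator x a s).degree < #s := by
  refine (degree_sum_le _ _).trans_lt ((Finset.sup_lt_iff (WithBot.bot_lt_coe _)).2 fun i hi => ?_)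
  have h1 := natDegree_C_mul_le (a i) (∏ j ∈ s.erase i, (X - C (x j)))
  rw [natDegree_finsetProd_X_sub_C_eq_card, card_erase_of_mem hi] at h1
  have h2 := card_pos.2 ⟨i, hi⟩
  exact degree_le_natDegree.trans_lt (by exact_mod_cast (show _ < #s by omega))

theorem numerator_union {κ : Type*} [DecidableEq κ] (x a : κ → F) {s t : Finset κ}
    (h : Disjoint s t) : numerator x a (s ∪ t) =
      numerator x a s * ∏ j ∈ t, (X - C (x j)) + numerator x a t * ∏ j ∈ s, (X - C (x j)) := by
  rw [numerator, sum_union h, numerator, numerator, sum_mul, sum_mul]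
  congr 1
  · refine sum_congr rfl fun i hi => ?_
    rw [erase_union_distrib, erase_eq_of_notMem (disjoint_left.1 h hi), mul_assoc,
      prod_union (h.mono_left (erase_subset _ _))]
  · refine sum_congr rfl fun i hi => ?_
    rw [erase_union_distrib, erase_eq_of_notMem (disjoint_right.1 h hi), mul_assoc,
      prod_union (h.mono_right (erase_subset _ _)), mul_comm (∏ j ∈ s, _)]

/-- Fractions are added along a balanced binary tree. -/
theorem computes_numerator {κ : Type*} [DecidableEq κ] (x : κ → F) (a : κ → Ω → F) (k : ℕ) :
    ∀ s : Finset κ, #s ≤ 2 ^ k → Computes {φ | ∃ i ∈ s, φ = a i} (2 ^ k * k * (mulCost k + 1))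
      (coeffs fun ω => numerator x (fun i => a i ω) s) := by
  induction k with
  | zero =>
    intro s hs
    refine .done ?_
    have hs' : #s ≤ 1 := by simpa using hs
    rcases s.eq_empty_or_nonempty with rfl | hne
    · rintro _ ⟨t, rfl⟩
      exact Or.inr ⟨0, by simp [numerator]⟩
    obtain ⟨i, rfl⟩ := card_eq_one.1 (hs'.antisymm (card_pos.2 hne))
    rintro _ ⟨t, rfl⟩
    simp only [numerator, sum_singleton, erase_singleton, prod_empty, mul_one, coeff_C]
    split_ifs
    · exact Or.inl ⟨i, mem_singleton_self i, rfl⟩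
    · exact const_mem_withConsts _ 0
  | succ k ih =>
    intro s hs
    obtain ⟨t, hts, htc⟩ := exists_subset_card_eq (s := s) (n := min (2 ^ k) #s) (min_le_right _ _)
    have ht : #t ≤ 2 ^ k := htc.trans_le (min_le_left _ _)
    have ht' : #(s \ t) ≤ 2 ^ k := by
      rw [card_sdiff_of_subset hts, htc]
      rw [pow_succ] at hs
      omega
    have hdisj : Disjoint t (s \ t) := disjoint_sdiff
    have hst : t ∪ (s \ t) = s := union_sdiff_of_subset hts
    have hdeg : ∀ t : Finset κ, (∏ j ∈ t, (X - C (x j))).natDegree = #t := fun t => by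
      simp
    have hmul : ∀ t t' : Finset κ, #t ≤ 2 ^ k → #t' ≤ 2 ^ k → t ⊆ s →
        Computes {φ | ∃ i ∈ s, φ = a i} (2 ^ k * k * (mulCost k + 1) + 2 ^ k * mulCost k)
          (coeffs fun ω => numerator x (fun i => a i ω) t * ∏ j ∈ t', (X - C (x j))) := by
      intro t t' ht ht' hts
      refine ((ih t ht).mono_source ?_).trans (computes_fixed_mul _ ((hdeg t').trans_le ht') _
        fun ω => (degree_numerator_lt _ _ _).trans_le (by exact_mod_cast ht))
      rintro _ ⟨i, hi, rfl⟩
      exact Or.inl ⟨i, hts hi, rfl⟩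
    have hdeg' : ∀ (t t' : Finset κ), #t ≤ 2 ^ k → #t' ≤ 2 ^ k → ∀ ω,
        (numerator x (fun i => a i ω) t * ∏ j ∈ t', (X - C (x j))).degree < (2 ^ (k + 1) : ℕ) := by
      intro t t' ht ht' ω
      rw [pow_succ, mul_two]
      exact degree_mul_lt_add ((degree_numerator_lt _ _ _).trans_le (by exact_mod_cast ht))
        ((hdeg t').trans_le ht')
    have hadd := (hmul t (s \ t) ht ht' hts).union (hmul (s \ t) t ht' ht sdiff_subset) |>.trans
      (computes_add (hdeg' t (s \ t) ht ht') (hdeg' (s \ t) t ht' ht)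
        (Set.subset_union_left.trans (subset_withConsts _))
        (Set.subset_union_right.trans (subset_withConsts _)))
    simp only [← numerator_union x _ hdisj, hst] at hadd
    refine hadd.mono_cost ?_
    have h1 := mulCost_mono (Nat.le_succ k)
    calc 2 ^ k * k * (mulCost k + 1) + 2 ^ k * mulCost k
          + (2 ^ k * k * (mulCost k + 1) + 2 ^ k * mulCost k) + 2 ^ (k + 1)
        = 2 ^ (k + 1) * (k + 1) * (mulCost k + 1) := by ring
      _ ≤ _ := Nat.mul_le_mul_left _ (Nat.add_le_add_right h1 1)

/-! ### Simultaneous reduction modulo fixed polynomials -/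

/-- Division by a fixed monic polynomial `M` is multiplication by the fixed quotient `X ^ n / M`. -/
theorem mul_divByMonic_X_pow {M g : F[X]} (hM : M.Monic) {n : ℕ} (hg : g.degree < n) :
    (g * (X ^ n /ₘ M)) /ₘ X ^ n = g /ₘ M := by
  by_contra hne
  set U := X ^ n /ₘ M
  set V := X ^ n %ₘ M
  set q := (g * U) /ₘ X ^ n
  set r := (g * U) %ₘ X ^ n
  have h1 : V + M * U = X ^ n := modByMonic_add_div _ _
  have h2 : r + X ^ n * q = g * U := modByMonic_add_div _ _
  have h3 : g %ₘ M + M * (g /ₘ M) = g := modByMonic_add_div _ _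
  have hV : V.degree < M.degree := degree_modByMonic_lt _ hM
  have hr : r.degree < n := by
    simpa using degree_modByMonic_lt (g * U) (monic_X_pow (R := F) n)
  have hρ : (g %ₘ M).degree < M.degree := degree_modByMonic_lt _ hM
  have h4 : (M * X ^ n) * (g /ₘ M - q) = r * M + g * V - g %ₘ M * X ^ n := by
    linear_combination X ^ n * h3 - M * h2 - g * h1
  have h5 : (M * X ^ n).degree = ((n + M.natDegree : ℕ) : WithBot ℕ) := by
    rw [degree_mul, degree_X_pow, degree_eq_natDegree hM.ne_zero, add_comm]
    rfl
  have h6 : ((M * X ^ n) * (g /ₘ M - q)).degree < ((n + M.natDegree : ℕ) : WithBot ℕ) := by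
    rw [degree_eq_natDegree hM.ne_zero] at hV hρ
    rw [h4]
    refine (degree_sub_le _ _).trans_lt (max_lt ((degree_add_le _ _).trans_lt (max_lt ?_ ?_)) ?_)
    · exact degree_mul_lt_add hr le_rfl
    · exact degree_mul_lt_add hg (natDegree_le_iff_degree_le.2 hV.le)
    · rw [add_comm n]
      exact degree_mul_lt_add hρ (natDegree_X_pow_le n)
  rw [degree_mul, h5, degree_eq_natDegree (sub_ne_zero.2 (Ne.symm hne))] at h6
  have h7 : n + M.natDegree + (g /ₘ M - q).natDegree < n + M.natDegree := by exact_mod_cast h6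
  omega

theorem computes_modByMonic {M : F[X]} (hM : M.Monic) {k : ℕ} (hMk : M.natDegree ≤ 2 ^ k)
    (g : Ω → F[X]) (hg : ∀ ω, (g ω).degree < (2 ^ k : ℕ)) :
    Computes (coeffs g) (2 ^ k * (2 * mulCost k + 1)) (coeffs fun ω => g ω %ₘ M) := by
  have h1 := computes_fixed_mul (X ^ (2 ^ k) /ₘ M) (k := k)
    (by rw [natDegree_divByMonic _ hM, natDegree_X_pow]; omega) g hg
  have h2 : coeffs (fun ω => g ω /ₘ M) ⊆
      withConsts (coeffs fun ω => g ω * (X ^ (2 ^ k) /ₘ M)) := by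
    rintro _ ⟨i, rfl⟩
    refine Or.inl ⟨i + 2 ^ k, funext fun ω => ?_⟩
    dsimp only
    rw [← mul_divByMonic_X_pow hM (hg ω)]
    conv_lhs => rw [← modByMonic_add_div (g ω * (X ^ 2 ^ k /ₘ M)) (X ^ 2 ^ k), coeff_add,
      coeff_X_pow_mul]
    rw [coeff_eq_zero_of_degree_lt, zero_add]
    refine (degree_modByMonic_lt _ (monic_X_pow _)).trans_le ?_
    rw [degree_X_pow]
    exact_mod_cast Nat.le_add_left _ _
  have h3 := computes_fixed_mul M hMk (fun ω => g ω /ₘ M)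
    fun ω => (degree_divByMonic_le _ _).trans_lt (hg ω)
  have h4 := ((h1.mono_target h2).trans h3).keep.trans
    (computes_sub (r := fun ω => g ω %ₘ M) (fun ω => (degree_modByMonic_le_left).trans_lt (hg ω))
      (fun ω => by rw [modByMonic_eq_sub_mul_div, mul_comm])
      (Set.subset_union_left.trans (subset_withConsts _))
      (Set.subset_union_right.trans (subset_withConsts _)))
  exact h4.mono_cost (le_of_eq (by ring))

/-- A list of weights is split at an item `c` such that prescribed bounds hold before and after `c`;
nothing is required of `c` itself, which may be heavy. -/
theorem exists_balanced_split {ι : Type*} (f : ι → ℕ) (l : List ι) : ∀ a b : ℕ,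
    (l.map f).sum ≤ a + b → l = [] ∨ ∃ l₁ c l₂, l = l₁ ++ c :: l₂ ∧ (l₁.map f).sum ≤ a ∧
      (l₂.map f).sum ≤ b := by
  induction l with
  | nil => exact fun _ _ _ => Or.inl rfl
  | cons i l ih =>
    intro a b h
    right
    rw [List.map_cons, List.sum_cons] at h
    rcases le_or_gt (f i) a with hi | hi
    · rcases ih (a - f i) b (by omega) with rfl | ⟨l₁, c, l₂, rfl, h1, h2⟩
      · exact ⟨[], i, [], rfl, by simp, by simp⟩
      · refine ⟨i :: l₁, c, l₂, rfl, ?_, h2⟩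
        rw [List.map_cons, List.sum_cons]
        omega
    · exact ⟨[], i, l, rfl, by simp, by omega⟩

/-- Residues modulo several fixed polynomials are computed along a binary tree. The list of moduli
is split at the modulus in the middle of the total degree; that modulus is treated by itself, so
that both remaining parts have at most half of the total degree. -/
theorem computes_residues (k : ℕ) : ∀ l : List F[X], (∀ m ∈ l, m.Monic) →
    (l.map natDegree).sum ≤ 2 ^ k → ∀ g : Ω → F[X], (∀ ω, (g ω).degree < (2 ^ k : ℕ)) →
    Computes (coeffs g) (2 ^ k * k * (6 * mulCost k + 3))
      (⋃ m ∈ l, coeffs fun ω => g ω %ₘ m) := by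
  induction k with
  | zero =>
    intro l hl hdeg g hg
    refine .done (Set.iUnion₂_subset fun m hm => ?_)
    rcases Nat.eq_zero_or_pos m.natDegree with h0 | h0
    · rintro _ ⟨i, rfl⟩
      exact Or.inr ⟨0, by simp [(hl m hm).natDegree_eq_zero.1 h0]⟩
    · have h1 : (fun ω => g ω %ₘ m) = g := funext fun ω =>
        (modByMonic_eq_self_iff (hl m hm)).2 ((hg ω).trans_le (by
          rw [degree_eq_natDegree (hl m hm).ne_zero]
          exact_mod_cast h0))
      rw [h1]
      exact subset_withConsts _
  | succ k ih =>
    intro l hl hdeg g hg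
    rcases exists_balanced_split natDegree l (2 ^ k) (2 ^ k) (by rw [pow_succ] at hdeg; omega) with
      rfl | ⟨l₁, c, l₂, rfl, h1, h2⟩
    · exact .done (by simp)
    have hmod := fun (m : F[X]) (hm : m.Monic) (hd : m.natDegree ≤ 2 ^ (k + 1)) =>
      computes_modByMonic hm hd g hg
    have hside : ∀ l' : List F[X], (∀ m ∈ l', m.Monic) → (l'.map natDegree).sum ≤ 2 ^ k →
        Computes (coeffs g) (2 ^ (k + 1) * (2 * mulCost (k + 1) + 1)
          + 2 ^ k * k * (6 * mulCost k + 3)) (⋃ m ∈ l', coeffs fun ω => g ω %ₘ m) := by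
      intro l' hl' hdeg'
      obtain ⟨hmon, hnat⟩ := monic_list_prod hl'
      have h3 := (hmod l'.prod hmon (by rw [hnat, pow_succ]; omega)).trans
        (ih l' hl' hdeg' (fun ω => g ω %ₘ l'.prod) fun ω =>
          (degree_modByMonic_lt _ hmon).trans_le (by
            rw [degree_eq_natDegree hmon.ne_zero, hnat]
            exact_mod_cast hdeg'))
      convert h3 using 6 with m hm ω
      refine (modByMonic_eq_of_dvd_sub (hl' m hm) ?_).symm
      refine (List.dvd_prod hm).trans ?_
      rw [modByMonic_eq_sub_mul_div, sub_sub_cancel_left]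
      exact (dvd_mul_right _ _).neg_right
    have hc : c ∈ l₁ ++ c :: l₂ := by simp
    have hcdeg : c.natDegree ≤ 2 ^ (k + 1) := le_trans (by simp; omega) hdeg
    have h3 := ((hside l₁ (fun m hm => hl m (by simp [hm])) h1).union
      (hmod c (hl c hc) hcdeg)).union (hside l₂ (fun m hm => hl m (by simp [hm])) h2)
    refine (h3.mono_cost ?_).mono_target ?_
    · have h4 := mulCost_mono (Nat.le_succ k)
      have h5 : 2 ^ k * k * (6 * mulCost k + 3) ≤ 2 ^ k * k * (6 * mulCost (k + 1) + 3) :=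
        Nat.mul_le_mul_left _ (by simp only [Nat.succ_eq_add_one] at h4; omega)
      calc _ ≤ 2 ^ (k + 1) * (2 * mulCost (k + 1) + 1) + 2 ^ k * k * (6 * mulCost (k + 1) + 3)
            + 2 ^ (k + 1) * (2 * mulCost (k + 1) + 1)
            + (2 ^ (k + 1) * (2 * mulCost (k + 1) + 1)
            + 2 ^ k * k * (6 * mulCost (k + 1) + 3)) := by gcongr
        _ = _ := by ring
    · refine Set.iUnion₂_subset fun m hm => Set.Subset.trans ?_ (subset_withConsts _)
      simp only [List.mem_append, List.mem_cons] at hm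
      rcases hm with hm | rfl | hm
      · exact (Set.subset_biUnion_of_mem (u := fun m => coeffs fun ω => g ω %ₘ m) hm).trans
          (Set.subset_union_left.trans Set.subset_union_left)
      · exact Set.subset_union_right.trans Set.subset_union_left
      · exact (Set.subset_biUnion_of_mem (u := fun m => coeffs fun ω => g ω %ₘ m) hm).trans
          Set.subset_union_right

/-- Interpolation followed by reduction: from the values of a polynomial, up to known factors
`μ i`, at as many points as its degree bound requires, all its residues are found. -/
theorem computes_residues_of_values {κ : Type*} [DecidableEq κ] {x : κ → F} {s : Finset κ}
    (hx : Set.InjOn x s) {k : ℕ} (hs : #s ≤ 2 ^ k) {H : Ω → F[X]} (hH : ∀ ω, (H ω).degree < #s)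
    {φ : κ → Ω → F} {μ : κ → F} (hφ : ∀ i ∈ s, ∀ ω, (H ω).eval (x i) = μ i * φ i ω)
    {l : List F[X]} (hl : ∀ m ∈ l, m.Monic) (hdeg : (l.map natDegree).sum ≤ 2 ^ k) :
    Computes {ψ | ∃ i ∈ s, ψ = φ i} (#s + 2 ^ k * k * (7 * mulCost k + 4))
      (⋃ m ∈ l, coeffs fun ω => H ω %ₘ m) := by
  set a : κ → Ω → F := fun i ω => ((∏ j ∈ s.erase i, (x i - x j)⁻¹) * μ i) * φ i ω with ha
  have h1 := Computes.biUnion (A := {ψ | ∃ i ∈ s, ψ = φ i}) s (fun _ => 1) (fun i => {a i})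
    fun i hi => Computes.const_mul _ (Or.inl ⟨i, hi, rfl⟩)
  have h2 := computes_numerator x a k s hs
  have h3 : (fun ω => numerator x (fun i => a i ω) s) = H := by
    funext ω
    rw [Lagrange.eq_interpolate hx (hH ω), Lagrange.interpolate_apply, numerator]
    refine sum_congr rfl fun i hi => ?_
    rw [Lagrange.basis, hφ i hi]
    simp only [Lagrange.basisDivisor, prod_mul_distrib, ha, ← map_prod, C_mul]
    ring
  rw [h3] at h2
  have h4 := h1.trans (h2.mono_source (by
    rintro _ ⟨i, hi, rfl⟩
    exact Or.inl (Set.mem_biUnion hi rfl)))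
  refine (h4.trans (computes_residues k l hl hdeg H fun ω =>
    (hH ω).trans_le (by exact_mod_cast hs))).mono_cost ?_
  rw [sum_const, smul_eq_mul, mul_one]
  exact le_of_eq (by ring)

end FastDecoding

namespace FastDecoding

open Polynomial

/-! ### Separation of the poles -/

section Poles

variable {F : Type u} [Field F]

/-- Polynomials with distinct orders of vanishing below `d` at a point `z` are linearly independent
modulo `(X - z) ^ d`; the coefficients of a linear combination are therefore linear functions of its
residue. -/
theorem exists_dual_modByMonic {ι : Type*} [Fintype ι] [DecidableEq ι] {z : F} {d : ℕ}
    {G : ι → F[X]} {e : ι → ℕ} (he : Function.Injective e) (hed : ∀ i, e i < d)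
    (hdvd : ∀ i, (X - C z) ^ e i ∣ G i) (hndvd : ∀ i, ¬ (X - C z) ^ (e i + 1) ∣ G i) :
    ∃ l : ι → F[X] →ₗ[F] F, ∀ i j, l i (G j %ₘ (X - C z) ^ d) = if i = j then 1 else 0 := by
  classical
  have hm : ((X - C z) ^ d).Monic := (monic_X_sub_C z).pow d
  have hli : LinearIndependent F fun i => G i %ₘ (X - C z) ^ d := by
    rw [Fintype.linearIndependent_iff]
    intro c hc
    by_contra! hne
    obtain ⟨i₀, hi₀⟩ := hne
    -- a term with a non-zero coefficient and the least order of vanishing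
    obtain ⟨i, hi, hmin⟩ := exists_min_image (univ.filter fun i => c i ≠ 0) e
      ⟨i₀, by simpa using hi₀⟩
    rw [mem_filter] at hi
    have h1 : (X - C z) ^ d ∣ ∑ j, c j • G j := by
      rw [← modByMonic_eq_zero_iff_dvd hm, ← modByMonicHom_apply, map_sum]
      simpa using hc
    have h2 : (X - C z) ^ (e i + 1) ∣ ∑ j ∈ univ.erase i, c j • G j := by
      refine dvd_sum fun j hj => ?_
      rcases eq_or_ne (c j) 0 with h0 | h0
      · rw [h0, zero_smul]; exact dvd_zero _
      · have h3 := hmin j (by simpa using h0)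
        have h4 : e i ≠ e j := fun h => (ne_of_mem_erase hj) (he h).symm
        rw [smul_eq_C_mul]
        exact ((pow_dvd_pow _ (by omega)).trans (hdvd j)).mul_left _
    have h3 := (Nat.succ_le_of_lt (hed i))
    have h4 := (dvd_add_left h2).1 (((pow_dvd_pow _ h3).trans h1).trans (by
      rw [add_sum_erase _ _ (mem_univ i)]))
    rw [smul_eq_C_mul] at h4
    exact hndvd i ((IsUnit.dvd_mul_left (isUnit_C.2 hi.2.isUnit)).1 h4)
  obtain ⟨g, hg⟩ := LinearMap.exists_leftInverse_of_injective
    (Finsupp.linearCombination F fun i => G i %ₘ (X - C z) ^ d) (LinearMap.ker_eq_bot.2 hli)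
  refine ⟨fun i => Finsupp.lapply i ∘ₗ g, fun i j => ?_⟩
  have h1 := LinearMap.congr_fun hg (Finsupp.single j 1)
  simp only [LinearMap.comp_apply, Finsupp.linearCombination_single, one_smul, LinearMap.id_apply]
    at h1
  rw [LinearMap.comp_apply, h1, Finsupp.lapply_apply, Finsupp.single_apply]
  exact if_congr eq_comm rfl rfl

variable {κ η : Type*} [Fintype η] (f : κ → η → F)

/-- The polynomial `∏ (X - f r q) ^ g r q` over `r ∈ s` and all `q`. -/
noncomputable def poleProd (s : Finset κ) (g : κ → η → ℕ) : F[X] :=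
  ∏ x ∈ s ×ˢ univ, (X - C (f x.1 x.2)) ^ g x.1 x.2

theorem poleProd_monic (s : Finset κ) (g : κ → η → ℕ) : (poleProd f s g).Monic :=
  monic_prod_of_monic _ _ fun _ _ => (monic_X_sub_C _).pow _

theorem natDegree_poleProd (s : Finset κ) (g : κ → η → ℕ) :
    (poleProd f s g).natDegree = ∑ r ∈ s, ∑ q, g r q := by
  rw [poleProd, natDegree_prod_of_monic _ _ fun _ _ => (monic_X_sub_C _).pow _,
    sum_product]
  simp

theorem eval_poleProd (s : Finset κ) (g : κ → η → ℕ) (z : F) :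
    (poleProd f s g).eval z = ∏ q, ∏ r ∈ s, (z - f r q) ^ g r q := by
  rw [poleProd, eval_prod, prod_product_right]
  simp

theorem pow_dvd_poleProd {s : Finset κ} (g : κ → η → ℕ) {r : κ} (hr : r ∈ s) (q : η) :
    (X - C (f r q)) ^ g r q ∣ poleProd f s g := by
  have h : (r, q) ∈ s ×ˢ (univ : Finset η) := mem_product.2 ⟨hr, mem_univ q⟩
  have h1 := dvd_prod_of_mem (fun x : κ × η => (X - C (f x.1 x.2)) ^ g x.1 x.2) h
  dsimp only at h1
  rw [poleProd]
  exact h1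

variable {f}

theorem not_pow_succ_dvd_poleProd_mul [DecidableEq κ] [DecidableEq η]
    (hf : ∀ r q r' q', f r q = f r' q' → r = r' ∧ q = q')
    {s s' : Finset κ} {g g' : κ → η → ℕ} {r : κ} {q : η} (hg : g r q = 0) (hr : r ∈ s') :
    ¬ (X - C (f r q)) ^ (g' r q + 1) ∣ poleProd f s g * poleProd f s' g' := by
  have hprime : Prime (X - C (f r q)) := prime_X_sub_C _
  have hne : ∀ x : κ × η, x ≠ (r, q) → ¬ (X - C (f r q)) ∣ X - C (f x.1 x.2) := by
    intro x hx h
    rw [dvd_iff_isRoot, IsRoot.def, eval_sub, eval_X, eval_C, sub_eq_zero] at h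
    obtain ⟨h1, h2⟩ := hf _ _ _ _ h
    exact hx (Prod.ext h1.symm h2.symm)
  rw [poleProd, poleProd, ← mul_prod_erase (s' ×ˢ univ) _
    (mem_product.2 ⟨hr, mem_univ q⟩ : (r, q) ∈ s' ×ˢ univ), mul_left_comm, pow_succ]
  intro h
  have h1 := (mul_dvd_mul_iff_left (pow_ne_zero _ hprime.ne_zero)).1 h
  rcases hprime.dvd_or_dvd h1 with h2 | h2
  · obtain ⟨x, hx, h3⟩ := (hprime.dvd_finsetProd_iff _).1 h2
    by_cases hxr : x = (r, q)
    · subst hxr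
      rw [hg, pow_zero] at h3
      exact hprime.not_isUnit (isUnit_of_dvd_one h3)
    · exact hne x hxr (hprime.dvd_of_dvd_pow h3)
  · obtain ⟨x, hx, h3⟩ := (hprime.dvd_finsetProd_iff _).1 h2
    exact hne x (ne_of_mem_erase hx) (hprime.dvd_of_dvd_pow h3)

theorem prod_pow_sub_ite [DecidableEq κ] {a : κ → η → F} {s : Finset κ} {r : κ} (hr : r ∈ s)
    (ha : ∀ q, a r q ≠ 0) {d e : η → ℕ} (hed : ∀ q, e q ≤ d q) :
    ∏ q, ∏ r' ∈ s, a r' q ^ (d q - if r' = r then e q else 0) =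
      (∏ q, ∏ r' ∈ s, a r' q ^ d q) * (∏ q, a r q ^ e q)⁻¹ := by
  rw [← prod_inv_distrib, ← prod_mul_distrib]
  refine prod_congr rfl fun q _ => ?_
  rw [← mul_prod_erase s _ hr, ← mul_prod_erase s _ hr, if_pos rfl, pow_sub₀ _ (ha q) (hed q)]
  rw [prod_congr rfl fun r' hr' => by rw [if_neg (ne_of_mem_erase hr'), Nat.sub_zero]]
  ring

theorem sum_sub_ite_add [DecidableEq κ] {s : Finset κ} {r : κ} (hr : r ∈ s) {d e : η → ℕ}
    (hed : ∀ q, e q ≤ d q) :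
    (∑ r' ∈ s, ∑ q, (d q - if r' = r then e q else 0)) + ∑ q, e q = #s * ∑ q, d q := by
  rw [← sum_const_nat (m := ∑ q, d q) (s := s) fun _ _ => rfl, ← add_sum_erase s _ hr,
    ← add_sum_erase s _ hr, add_right_comm, ← sum_add_distrib]
  congr 1
  · exact sum_congr rfl fun q _ => by rw [if_pos rfl, Nat.sub_add_cancel (hed q)]
  · exact sum_congr rfl fun r' hr' => by simp [if_neg (ne_of_mem_erase hr')]

end Poles

end FastDecoding

namespace FastDecoding

open Polynomial

/-! ### Power assignments of Type 2 -/

section PowerAssignments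

variable {LA LB : ℕ} {S : Finset (Fin LA × Fin LB)}

theorem card_type2Task_groupB (q : Fin LA) : #((type2Task S).groupB q) = degA S q := rfl

theorem type2Task_size (q : Fin LA) : (type2Task S).size q = degA S q := by
  simp [TaskAssignment.size, type2Task, degA]

theorem mem_type2Task_groupB {q : Fin LA} {j : Fin LB} :
    j ∈ (type2Task S).groupB q ↔ (q, j) ∈ S := by
  simp [type2Task]

theorem sum_degA (S : Finset (Fin LA × Fin LB)) : ∑ q, degA S q = #S := by
  simp only [degA, card_filter]
  rw [← Fintype.sum_prod_type (fun x : Fin LA × Fin LB => if x ∈ S then 1 else 0), ← card_filter,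
    filter_mem_eq_inter, univ_inter]

theorem degA_le_card (S : Finset (Fin LA × Fin LB)) (q : Fin LA) : degA S q ≤ #S := by
  rw [← sum_degA]
  exact single_le_sum (f := degA S) (fun _ _ => Nat.zero_le _) (mem_univ q)

variable (P : PowerAssignment (type2Task S))

theorem powA_eq (q i : Fin LA) : P.powA q i = if i = q then degA S q else 0 := by
  split_ifs with h
  · subst h
    have hmem : i ∈ (type2Task S).groupA i := by simp [type2Task]
    have hcard : #((type2Task S).groupA i) = 1 := by simp [type2Task]
    rcases P.admissible i with ⟨h1, -⟩ | ⟨-, h1⟩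
    · obtain ⟨x, hx, h2⟩ := h1 i hmem
      rw [hcard, mem_Icc] at hx
      rw [type2Task_size] at h2
      omega
    · obtain ⟨y, hy, h2⟩ := h1 i hmem
      rw [hcard, mem_Icc] at hy
      rw [h2, show y = 1 by omega, one_mul, card_type2Task_groupB]
  · exact P.powA_eq_zero q i (by simpa [type2Task] using h)

theorem powB_mem_Icc {q : Fin LA} {j : Fin LB} (h : (q, j) ∈ S) :
    P.powB q j ∈ Icc 1 (degA S q) := by
  have hmem := mem_type2Task_groupB.2 h
  have hcard : #((type2Task S).groupA q) = 1 := by simp [type2Task]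
  rcases P.admissible q with ⟨-, h1⟩ | ⟨h1, -⟩
  · obtain ⟨y, hy, h2⟩ := h1 j hmem
    rwa [h2, hcard, mul_one]
  · obtain ⟨x, hx, h2⟩ := h1 j hmem
    rw [card_type2Task_groupB, mem_Icc] at hx
    rw [type2Task_size] at h2
    rw [mem_Icc]
    omega

theorem powB_eq_zero {q : Fin LA} {j : Fin LB} (h : (q, j) ∉ S) : P.powB q j = 0 :=
  P.powB_eq_zero q j (by rwa [mem_type2Task_groupB])

theorem powB_le (q : Fin LA) (j : Fin LB) : P.powB q j ≤ degA S q := by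
  by_cases h : (q, j) ∈ S
  · exact (mem_Icc.1 (powB_mem_Icc P h)).2
  · rw [powB_eq_zero P h]; exact Nat.zero_le _

theorem powB_injOn (q : Fin LA) : Set.InjOn (P.powB q) {j | (q, j) ∈ S} := by
  intro j hj j' hj' h
  refine P.powB_distinct q j j' ?_ ?_ h
  · have := (mem_Icc.1 (powB_mem_Icc P hj)).1; omega
  · have := (mem_Icc.1 (powB_mem_Icc P hj')).1; omega

/-- The exponents of the `d` matrices in a group are the numbers from `1` to `d`. -/
theorem exists_powB_eq_one {q : Fin LA} (hq : 0 < degA S q) : ∃ j, P.powB q j = 1 := by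
  have h1 : ((type2Task S).groupB q).image (P.powB q) = Icc 1 (degA S q) := by
    refine eq_of_subset_of_card_le (image_subset_iff.2 fun j hj =>
      powB_mem_Icc P (mem_type2Task_groupB.1 hj)) ?_
    rw [card_image_of_injOn, card_type2Task_groupB, Nat.card_Icc, Nat.add_sub_cancel]
    exact (powB_injOn P q).mono fun j hj => mem_type2Task_groupB.1 hj
  have h2 : 1 ∈ ((type2Task S).groupB q).image (P.powB q) := by
    rw [h1, mem_Icc]; omega
  obtain ⟨j, -, hj⟩ := mem_image.1 h2
  exact ⟨j, hj⟩

theorem iInf_degA_le (hS : ∀ i, 0 < degA S i) (i : Fin LA) :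
    (⨅ i : {i : Fin LA // degA S i ≠ 0}, degA S i.1) ≤ degA S i :=
  ciInf_le (OrderBot.bddBelow _) (⟨i, (hS i).ne'⟩ : {i : Fin LA // degA S i ≠ 0})

theorem iInf_powB_le (j : Fin LB) : (⨅ j : Fin LB, ∑ q, P.powB q j) ≤ ∑ q, P.powB q j :=
  ciInf_le (OrderBot.bddBelow _) j

/-- The threshold is at least the number `R * #S` of the products `A_i^r B_j^r` that are to be
found: some `B_j` has exponent `1` in a given group. -/
theorem mul_card_le_type2Threshold (hLA : 0 < LA) (hS : ∀ i, 0 < degA S i) (R : ℕ) {ρ : ℕ}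
    (hρ : 0 < ρ) : ((R * #S : ℕ) : ℤ) ≤ type2Threshold S P R ρ := by
  set q₀ : Fin LA := ⟨0, hLA⟩
  obtain ⟨j, hj⟩ := exists_powB_eq_one P (hS q₀)
  have h1 := iInf_degA_le hS q₀
  have h2 := iInf_powB_le P j
  have h3 : ∑ q, P.powB q j + degA S q₀ ≤ 1 + #S := by
    rw [← sum_degA, ← add_sum_erase _ _ (mem_univ q₀), ← add_sum_erase univ _ (mem_univ q₀), hj]
    have := sum_le_sum fun q (_ : q ∈ univ.erase q₀) => powB_le P q j
    omega
  have h4 : #S ≤ ρ * #S := Nat.le_mul_of_pos_left _ hρ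
  rw [type2Threshold, add_mul]
  zify at h1 h2 h3 h4
  push_cast
  linarith

end PowerAssignments

/-! ### The response as a rational function -/

section Response

variable {F : Type u} [Field F] {LA LB α β γ m p n K ρ : ℕ} {S : Finset (Fin LA × Fin LB)}
  (D : FCCChoice F m p n LA K) (P : PowerAssignment (type2Task S))

local notation "RR" => bilinearComplexity F m p n

theorem f_inj (r : Fin RR) (q : Fin LA) (r' : Fin RR) (q' : Fin LA) (h : D.f r q = D.f r' q') :
    r = r' ∧ q = q' := by
  have := @D.distinct (Sum.inl (r, q)) (Sum.inl (r', q')) h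
  simpa using this

theorem x_ne_f (k : Fin K) (r : Fin RR) (q : Fin LA) : D.x k - D.f r q ≠ 0 := by
  intro h
  have := @D.distinct (Sum.inr k) (Sum.inl (r, q)) (sub_eq_zero.1 h)
  simp at this

theorem x_injective : Function.Injective D.x := fun k k' h => by
  have := @D.distinct (Sum.inr k) (Sum.inr k') h
  simpa using this

theorem card_part_le (h : Fin (RR / ρ)) (hρ : 0 < ρ) : #(FCCChoice.part F m p n ρ h) ≤ ρ := by
  have h1 : (FCCChoice.part F m p n ρ h).image (fun r : Fin RR => (r : ℕ) % ρ) ⊆ range ρ :=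
    image_subset_iff.2 fun r _ => mem_range.2 (Nat.mod_lt _ hρ)
  have h2 := card_le_card h1
  rwa [card_image_of_injOn, card_range] at h2
  intro r hr r' hr' hmod
  simp only [FCCChoice.part, coe_filter, mem_univ, true_and, Set.mem_ofPred_eq] at hr hr'
  apply Fin.ext
  rw [← Nat.div_add_mod r ρ, ← Nat.div_add_mod r' ρ, hr, hr']
  exact congrArg _ hmod

/-- `Θ_h / a_i^r` as a polynomial; since each exponent in `a_i^r` is at most the one in `Θ_h`, the
subtraction does not truncate. -/
noncomputable def cofactorA (h : Fin (RR / ρ)) (i : Fin LA) (r : Fin RR) : F[X] :=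
  poleProd D.f (FCCChoice.part F m p n ρ h)
    fun r' q => degA S q - if r' = r then P.powA q i else 0

/-- `∏ (X - f_{r,q}) ^ {d^A_q} / b_j^r` as a polynomial; the product is over all `r` and `q`. -/
noncomputable def cofactorB (j : Fin LB) (r : Fin RR) : F[X] :=
  poleProd D.f univ fun r' q => degA S q - if r' = r then P.powB q j else 0

/-- The product of all `(X - f_{r,q}) ^ {d^A_q}`, a common denominator of the responses. -/
noncomputable def denominator (S : Finset (Fin LA × Fin LB)) : F[X] :=
  poleProd D.f univ fun _ q => degA S q

theorem powA_le (q i : Fin LA) : P.powA q i ≤ degA S q := by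
  rw [powA_eq]; split_ifs <;> omega

theorem sum_powA (i : Fin LA) : ∑ q, P.powA q i = degA S i := by
  simp [powA_eq]

theorem eval_cofactorA {h : Fin (RR / ρ)} {i : Fin LA} {r : Fin RR}
    (hr : r ∈ FCCChoice.part F m p n ρ h) (k : Fin K) :
    (cofactorA D P h i r).eval (D.x k) =
      D.theta (type2Task S) ρ h (D.x k) * (D.denA P r i (D.x k))⁻¹ := by
  rw [cofactorA, eval_poleProd, prod_pow_sub_ite (a := fun r q => D.x k - D.f r q) hr
    (x_ne_f D k r) (fun q => powA_le P q i)]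
  simp only [FCCChoice.theta, FCCChoice.denA, type2Task_size]

theorem eval_cofactorB (j : Fin LB) (r : Fin RR) (k : Fin K) :
    (cofactorB D P j r).eval (D.x k) =
      (denominator D S).eval (D.x k) * (D.denB P r j (D.x k))⁻¹ := by
  rw [cofactorB, eval_poleProd, prod_pow_sub_ite (a := fun r q => D.x k - D.f r q) (mem_univ r)
    (x_ne_f D k r) (fun q => powB_le P q j), denominator, eval_poleProd]
  rfl

theorem natDegree_cofactor_mul_lt (hS : ∀ i, 0 < degA S i) (hρ : 0 < ρ) {h : Fin (RR / ρ)}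
    {i : Fin LA} {r r' : Fin RR} (hr : r ∈ FCCChoice.part F m p n ρ h) (j : Fin LB) :
    ((cofactorA D P h i r * cofactorB D P j r').natDegree : ℤ) < type2Threshold S P RR ρ := by
  rw [cofactorA, cofactorB, (poleProd_monic _ _ _).natDegree_mul (poleProd_monic _ _ _),
    natDegree_poleProd, natDegree_poleProd, type2Threshold]
  have h1 := sum_sub_ite_add hr (d := degA S) (e := fun q => P.powA q i) fun q => powA_le P q i
  have h2 := sum_sub_ite_add (mem_univ r') (d := degA S) (e := fun q => P.powB q j)
    fun q => powB_le P q j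
  rw [sum_powA, sum_degA] at h1
  rw [sum_degA, card_univ, Fintype.card_fin] at h2
  have h3 : #(FCCChoice.part F m p n ρ h) * #S ≤ ρ * #S :=
    Nat.mul_le_mul_right _ (card_part_le h hρ)
  have h4 := iInf_degA_le hS i
  have h5 := iInf_powB_le P j
  rw [add_mul]
  zify at h1 h2 h3 h4 h5 ⊢
  linarith

/-- The inputs of the computation, `𝐀_i` and `𝐁_j`. -/
abbrev Data (F : Type u) (LA LB α β γ : ℕ) : Type u :=
  (Fin LA → Matrix (Fin α) (Fin β) F) × (Fin LB → Matrix (Fin β) (Fin γ) F)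

/-- An entry of `A_i^r B_j^{r'}`. -/
noncomputable def entry (s : Fin (α / m)) (t : Fin (γ / n)) (i : Fin LA) (r : Fin RR) (j : Fin LB)
    (r' : Fin RR) (ω : Data F LA LB α β γ) : F :=
  (D.subA r (ω.1 i) * D.subB r' (ω.2 j)) s t

/-- An entry of the response, multiplied by the common denominator. -/
noncomputable def responsePoly (ρ : ℕ) (s : Fin (α / m)) (t : Fin (γ / n))
    (ω : Data F LA LB α β γ) : F[X] :=
  ∑ h : Fin (RR / ρ), ∑ i, ∑ r ∈ FCCChoice.part F m p n ρ h, ∑ j,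
    ∑ r' ∈ FCCChoice.part F m p n ρ h,
      entry D s t i r j r' ω • (cofactorA D P h i r * cofactorB D P j r')

theorem eval_responsePoly (s : Fin (α / m)) (t : Fin (γ / n)) (ω : Data F LA LB α β γ)
    (k : Fin K) : (responsePoly D P ρ s t ω).eval (D.x k) =
      (denominator D S).eval (D.x k) * D.response P ρ ω.1 ω.2 k s t := by
  have h1 : D.response P ρ ω.1 ω.2 k s t
      = ∑ h : Fin (RR / ρ), (D.polyA P ρ ω.1 h (D.x k) * D.polyB P ρ ω.2 h (D.x k)) s t := by
    simp only [FCCChoice.response, Matrix.mul_apply, FCCChoice.encodeA, FCCChoice.encodeB,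
      Matrix.of_apply]
    rw [Fintype.sum_prod_type]
  rw [h1, responsePoly, eval_finsetSum, mul_sum]
  refine sum_congr rfl fun h _ => ?_
  simp only [FCCChoice.polyA, FCCChoice.polyB, eval_finsetSum, Matrix.sum_mul, Matrix.mul_sum,
    Matrix.smul_mul, Matrix.mul_smul, Matrix.smul_apply, Matrix.sum_apply, smul_eq_mul, mul_sum,
    smul_sum]
  have hswap : ∀ (I : Finset (Fin RR)) (G : Fin LA → Fin RR → Fin LB → Fin RR → F),
      ∑ i, ∑ r ∈ I, ∑ j, ∑ r' ∈ I, G i r j r' = ∑ j, ∑ r' ∈ I, ∑ i, ∑ r ∈ I, G i r j r' := by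
    intro I G
    rw [sum_congr rfl fun i _ => sum_comm, sum_comm]
    refine sum_congr rfl fun j _ => ?_
    rw [sum_congr rfl fun i _ => sum_comm, sum_comm]
  refine (hswap _ _).trans ?_
  refine sum_congr rfl fun j _ => sum_congr rfl fun r' _ => sum_congr rfl fun i _ =>
    sum_congr rfl fun r hr => ?_
  rw [eval_smul, eval_mul, eval_cofactorA D P hr, eval_cofactorB, entry, smul_eq_mul]
  ring

theorem degree_responsePoly_lt (hS : ∀ i, 0 < degA S i) (hρ : 0 < ρ) {N : ℕ}
    (hN : (N : ℤ) = type2Threshold S P RR ρ) (s : Fin (α / m)) (t : Fin (γ / n))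
    (ω : Data F LA LB α β γ) : (responsePoly D P ρ s t ω).degree < N := by
  rw [← mem_degreeLT, responsePoly]
  refine Submodule.sum_mem _ fun h _ => Submodule.sum_mem _ fun i _ => Submodule.sum_mem _
    fun r hr => Submodule.sum_mem _ fun j _ => Submodule.sum_mem _ fun r' _ =>
      Submodule.smul_mem _ _ ?_
  rw [mem_degreeLT]
  have h1 := natDegree_cofactor_mul_lt D P hS hρ (r' := r') (i := i) hr j
  rw [← hN] at h1
  exact degree_le_natDegree.trans_lt (by exact_mod_cast h1)

/-- The interference terms have no pole at `f_{r₀,q₀}`. -/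
theorem pow_dvd_cofactor_mul {h : Fin (RR / ρ)} {i q₀ : Fin LA} {r r' r₀ : Fin RR} {j : Fin LB}
    (hr' : r' ∈ FCCChoice.part F m p n ρ h)
    (hne : ¬ (r = r₀ ∧ i = q₀ ∧ r' = r₀ ∧ (q₀, j) ∈ S)) :
    (X - C (D.f r₀ q₀)) ^ degA S q₀ ∣ cofactorA D P h i r * cofactorB D P j r' := by
  by_cases hB : r₀ = r' ∧ (q₀, j) ∈ S
  · obtain ⟨rfl, hj⟩ := hB
    have h1 := pow_dvd_poleProd D.f (fun r' q => degA S q - if r' = r then P.powA q i else 0) hr' q₀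
    refine Dvd.dvd.mul_right ?_ _
    rw [cofactorA]
    convert h1 using 2
    split_ifs with h2
    · rw [powA_eq, if_neg fun h3 => hne ⟨h2.symm, h3, rfl, hj⟩, Nat.sub_zero]
    · rw [Nat.sub_zero]
  · have h1 := pow_dvd_poleProd D.f (fun r'' q => degA S q - if r'' = r' then P.powB q j else 0)
      (mem_univ r₀) q₀
    refine Dvd.dvd.mul_left ?_ _
    rw [cofactorB]
    convert h1 using 2
    split_ifs with h2
    · rw [powB_eq_zero P fun h3 => hB ⟨h2, h3⟩, Nat.sub_zero]
    · rw [Nat.sub_zero]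

theorem exists_mem_part (hρ : ρ ∣ RR) (r : Fin RR) :
    ∃ h : Fin (RR / ρ), r ∈ FCCChoice.part F m p n ρ h := by
  exact ⟨⟨r / ρ, Nat.div_lt_div_of_lt_of_dvd hρ r.2⟩, by simp [FCCChoice.part]⟩

theorem eq_of_mem_part {h h' : Fin (RR / ρ)} {r : Fin RR} (hr : r ∈ FCCChoice.part F m p n ρ h)
    (hr' : r ∈ FCCChoice.part F m p n ρ h') : h = h' := by
  simp only [FCCChoice.part, mem_filter, mem_univ, true_and] at hr hr'
  exact Fin.ext (hr.symm.trans hr')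

/-- Only the products `A_q^r B_j^r` with `(q, j) ∈ S` are visible in the polar part at `f_{r,q}`. -/
theorem responsePoly_modByMonic {h : Fin (RR / ρ)} {r : Fin RR}
    (hr : r ∈ FCCChoice.part F m p n ρ h) (q : Fin LA) (s : Fin (α / m)) (t : Fin (γ / n))
    (ω : Data F LA LB α β γ) :
    responsePoly D P ρ s t ω %ₘ (X - C (D.f r q)) ^ degA S q =
      ∑ j : {j // (q, j) ∈ S}, entry D s t q r j.1 r ω •
        ((cofactorA D P h q r * cofactorB D P j.1 r) %ₘ (X - C (D.f r q)) ^ degA S q) := by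
  have hm : ((X - C (D.f r q)) ^ degA S q).Monic := (monic_X_sub_C _).pow _
  have hzero : ∀ h', ∀ i, ∀ r₁ ∈ FCCChoice.part F m p n ρ h', ∀ j,
      ∀ r₂ ∈ FCCChoice.part F m p n ρ h', ¬ (r₁ = r ∧ i = q ∧ r₂ = r ∧ (q, j) ∈ S) →
      entry D s t i r₁ j r₂ ω • ((cofactorA D P h' i r₁ * cofactorB D P j r₂) %ₘ
        (X - C (D.f r q)) ^ degA S q) = 0 := by
    intro h' i r₁ _ j r₂ hr₂ hne
    rw [(modByMonic_eq_zero_iff_dvd hm).2 (pow_dvd_cofactor_mul D P hr₂ hne), smul_zero]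
  rw [responsePoly, ← modByMonicHom_apply]
  simp only [map_sum, map_smul, modByMonicHom_apply]
  rw [sum_eq_single h]
  · rw [sum_eq_single q]
    · rw [sum_eq_single_of_mem r hr]
      · rw [← sum_subtype (univ.filter fun j => (q, j) ∈ S) (by simp)
          (fun j => entry D s t q r j r ω •
          ((cofactorA D P h q r * cofactorB D P j r) %ₘ (X - C (D.f r q)) ^ degA S q)), sum_filter]
        refine sum_congr rfl fun j _ => ?_
        split_ifs with hj
        · exact sum_eq_single_of_mem r hr fun r₂ hr₂ hne =>
            hzero _ _ _ hr _ _ hr₂ fun h1 => hne h1.2.2.1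
        · exact sum_eq_zero fun r₂ hr₂ => hzero _ _ _ hr _ _ hr₂ fun h1 => hj h1.2.2.2
      · intro r₁ hr₁ hne
        exact sum_eq_zero fun j _ => sum_eq_zero fun r₂ hr₂ =>
          hzero _ _ _ hr₁ _ _ hr₂ fun h1 => hne h1.1
    · intro i _ hne
      exact sum_eq_zero fun r₁ hr₁ => sum_eq_zero fun j _ => sum_eq_zero fun r₂ hr₂ =>
        hzero _ _ _ hr₁ _ _ hr₂ fun h1 => hne h1.2.1
    · simp
  · intro h' _ hne
    exact sum_eq_zero fun i _ => sum_eq_zero fun r₁ hr₁ => sum_eq_zero fun j _ =>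
      sum_eq_zero fun r₂ hr₂ => hzero _ _ _ hr₁ _ _ hr₂ fun h1 =>
        hne (eq_of_mem_part (h1.1 ▸ hr₁) hr)
  · simp

end Response

end FastDecoding

namespace FastDecoding

open Polynomial

/-! ### Decoding -/

section Decoding

variable {F : Type u} [Field F] {LA LB α β γ m p n K ρ : ℕ} {S : Finset (Fin LA × Fin LB)}
  (D : FCCChoice F m p n LA K) (P : PowerAssignment (type2Task S))

local notation "RR" => bilinearComplexity F m p n

/-- The polar part at `f_{r,q}` gives the products `A_q^r B_j^r`: the cofactors have distinct
orders of vanishing there, since the exponents in the group are distinct. -/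
theorem computes_entry (hρ : ρ ∣ RR) {q : Fin LA} {j : Fin LB} (hj : (q, j) ∈ S) (r : Fin RR)
    (s : Fin (α / m)) (t : Fin (γ / n)) :
    Computes (coeffs fun ω : Data F LA LB α β γ =>
        responsePoly D P ρ s t ω %ₘ (X - C (D.f r q)) ^ degA S q)
      (2 * degA S q) {entry D s t q r j r} := by
  classical
  obtain ⟨h, hr⟩ := exists_mem_part hρ r
  have hpow : ∀ j : {j // (q, j) ∈ S}, 1 ≤ P.powB q j.1 ∧ P.powB q j.1 ≤ degA S q := fun j =>
    mem_Icc.1 (powB_mem_Icc P j.2)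
  have hexp : ∀ j : Fin LB, (degA S q - if r = r then P.powB q j else 0)
      = degA S q - P.powB q j := fun j => by rw [if_pos rfl]
  obtain ⟨l, hl⟩ := exists_dual_modByMonic (ι := {j // (q, j) ∈ S}) (z := D.f r q) (d := degA S q)
    (G := fun j => cofactorA D P h q r * cofactorB D P j.1 r)
    (e := fun j => degA S q - P.powB q j.1)
    (fun j j' hjj => Subtype.ext (powB_injOn P q j.2 j'.2 (by
      have := hpow j; have := hpow j'; dsimp only at hjj; omega)))
    (fun j => by have := hpow j; omega)
    (fun j => by
      have h1 := pow_dvd_poleProd D.f (fun r' q => degA S q - if r' = r then P.powB q j else 0)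
        (mem_univ r) q
      rw [hexp] at h1
      exact h1.mul_left _)
    (fun j => by
      have h1 := not_pow_succ_dvd_poleProd_mul (f_inj D) (s := FCCChoice.part F m p n ρ h)
        (s' := univ) (g := fun r' q' => degA S q' - if r' = r then P.powA q' q else 0)
        (g' := fun r' q => degA S q - if r' = r then P.powB q j else 0) (r := r) (q := q)
        (by rw [if_pos rfl, powA_eq, if_pos rfl, Nat.sub_self]) (mem_univ r)
      rw [hexp] at h1
      exact h1)
  have hm : ((X - C (D.f r q)) ^ degA S q).Monic := (monic_X_sub_C _).pow _
  have hentry : ∀ ω : Data F LA LB α β γ, entry D s t q r j r ω =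
      ∑ i ∈ range (degA S q), l ⟨j, hj⟩ (X ^ i) *
        (responsePoly D P ρ s t ω %ₘ (X - C (D.f r q)) ^ degA S q).coeff i := by
    intro ω
    set g := responsePoly D P ρ s t ω %ₘ (X - C (D.f r q)) ^ degA S q with hg
    have h1 : l ⟨j, hj⟩ g = entry D s t q r j r ω := by
      rw [hg, responsePoly_modByMonic D P hr q s t ω, map_sum]
      simp only [map_smul, hl, smul_eq_mul, mul_ite, mul_one, mul_zero]
      rw [sum_ite_eq univ (⟨j, hj⟩ : {j // (q, j) ∈ S}), if_pos (mem_univ _)]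
    have h2 : g = ∑ i ∈ range (degA S q), g.coeff i • X ^ i := by
      ext i
      simp only [finsetSum_coeff, coeff_smul, coeff_X_pow, smul_eq_mul, mul_ite, mul_one, mul_zero,
        sum_ite_eq, mem_range]
      split_ifs with hi
      · rfl
      · refine coeff_eq_zero_of_degree_lt ((degree_modByMonic_lt _ hm).trans_le ?_)
        rw [degree_pow, degree_X_sub_C, nsmul_one]
        exact_mod_cast not_lt.1 hi
    rw [← h1]
    conv_lhs => rw [h2]
    rw [map_sum]
    exact sum_congr rfl fun i _ => by rw [map_smul, smul_eq_mul, mul_comm]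
  have h1 := Computes.linear_combination (range (degA S q)) (fun i => l ⟨j, hj⟩ (X ^ i))
    (fun i (ω : Data F LA LB α β γ) =>
      (responsePoly D P ρ s t ω %ₘ (X - C (D.f r q)) ^ degA S q).coeff i)
    (A := coeffs fun ω : Data F LA LB α β γ =>
        responsePoly D P ρ s t ω %ₘ (X - C (D.f r q)) ^ degA S q)
    fun i _ => Or.inl ⟨i, rfl⟩
  rw [card_range] at h1
  convert h1 using 2
  exact funext hentry

/-- The cost of interpolation from `N` values and of the reduction modulo the
`(X - f_{r,q}) ^ {d_q}`. -/
def interpolationCost (N : ℕ) : ℕ :=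
  N + 2 ^ Nat.clog 2 N * Nat.clog 2 N * (7 * mulCost (Nat.clog 2 N) + 4)

/-- The decoding of one entry of the responses. -/
theorem computes_entries (hLA : 0 < LA) (hS : ∀ i, 0 < degA S i) (hρ : ρ ∣ RR) (hρ0 : 0 < ρ) {N : ℕ}
    (hN : (N : ℤ) = type2Threshold S P RR ρ) {W : Finset (Fin K)} (hW : #W = N)
    (s : Fin (α / m)) (t : Fin (γ / n)) :
    Computes {φ | ∃ k ∈ W, φ = fun ω : Data F LA LB α β γ => D.response P ρ ω.1 ω.2 k s t}
      (interpolationCost N + 2 * (RR * #S ^ 2))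
      {φ | ∃ r, ∃ x ∈ S, φ = entry D s t x.1 r x.2 r} := by
  have hNle : N ≤ 2 ^ Nat.clog 2 N := Nat.le_pow_clog (by norm_num) N
  have h1 := computes_residues_of_values (Ω := Data F LA LB α β γ) (x := D.x) (s := W)
    (x_injective D).injOn (hW.trans_le hNle) (H := responsePoly D P ρ s t)
    (fun ω => by rw [hW]; exact degree_responsePoly_lt D P hS hρ0 hN s t ω)
    (φ := fun k ω => D.response P ρ ω.1 ω.2 k s t) (fun k _ ω => eval_responsePoly D P s t ω k)
    (l := (univ : Finset (Fin RR × Fin LA)).toList.map fun x =>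
      (X - C (D.f x.1 x.2)) ^ degA S x.2)
    (by
      intro g hg
      obtain ⟨x, -, rfl⟩ := List.mem_map.1 hg
      exact (monic_X_sub_C _).pow _)
    (by
      rw [List.map_map, sum_map_toList]
      simp only [Function.comp_apply, natDegree_pow, natDegree_X_sub_C, mul_one]
      rw [Fintype.sum_prod_type]
      simp only [sum_degA, sum_const, card_univ, Fintype.card_fin, smul_eq_mul]
      have := mul_card_le_type2Threshold P hLA hS RR hρ0
      rw [← hN] at this
      exact (by exact_mod_cast this : RR * #S ≤ N).trans hNle)
  rw [hW] at h1
  have h2 := Computes.biUnion (A := ⋃ g ∈ (univ : Finset (Fin RR × Fin LA)).toList.map fun x =>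
      (X - C (D.f x.1 x.2)) ^ degA S x.2,
      coeffs fun ω : Data F LA LB α β γ => responsePoly D P ρ s t ω %ₘ g)
    (univ ×ˢ S) (fun _ => 2 * #S)
    (fun x : Fin RR × (Fin LA × Fin LB) => {entry D s t x.2.1 x.1 x.2.2 x.1}) fun x hx => by
      refine ((computes_entry D P hρ (mem_product.1 hx).2 x.1 s t).mono_cost
        (Nat.mul_le_mul_left 2 (degA_le_card S _))).mono_source ?_
      refine Set.Subset.trans ?_ (subset_withConsts _)
      exact Set.subset_biUnion_of_mem (u := fun g : F[X] =>
        coeffs fun ω : Data F LA LB α β γ => responsePoly D P ρ s t ω %ₘ g)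
        (List.mem_map.2 ⟨(x.1, x.2.1), by simp, rfl⟩)
  refine ((h1.trans h2).mono_cost ?_).mono_target ?_
  · rw [sum_const, card_product, card_univ, Fintype.card_fin, smul_eq_mul, interpolationCost]
    exact le_of_eq (by ring)
  · rintro _ ⟨r, x, hx, rfl⟩
    exact Or.inl (Set.mem_biUnion (x := (r, x)) (mem_coe.2 (mem_product.2 ⟨mem_univ r, hx⟩)) rfl)

end Decoding

/-! ### Block matrices -/

section Blocks

theorem exists_blockIndex {α m : ℕ} (hm : m ∣ α) (a : Fin α) :
    ∃ (k : Fin m) (s : Fin (α / m)), a = blockIndex k s := by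
  have ha := a.2
  have h1 : m * (α / m) = α := Nat.mul_div_cancel' hm
  have h2 : 0 < α / m := Nat.pos_of_ne_zero fun h0 => by rw [h0, mul_zero] at h1; omega
  refine ⟨⟨a / (α / m), Nat.div_lt_of_lt_mul (by rwa [mul_comm, h1])⟩,
    ⟨a % (α / m), Nat.mod_lt _ h2⟩, Fin.ext ?_⟩
  simp only [blockIndex]
  rw [mul_comm, Nat.div_add_mod]

theorem sum_blockIndex {M : Type*} [AddCommMonoid M] {β p : ℕ} (hp : p ∣ β) (g : Fin β → M) :
    ∑ b, g b = ∑ k : Fin p, ∑ s : Fin (β / p), g (blockIndex k s) := by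
  rw [← Fintype.sum_prod_type (fun x : Fin p × Fin (β / p) => g (blockIndex x.1 x.2))]
  refine (Fintype.sum_bijective (fun x : Fin p × Fin (β / p) => blockIndex x.1 x.2) ?_ _ _
    fun _ => rfl).symm
  rw [Fintype.bijective_iff_surjective_and_card]
  refine ⟨fun b => ?_, by simp [Nat.mul_div_cancel' hp]⟩
  obtain ⟨k, s, rfl⟩ := exists_blockIndex hp b
  exact ⟨(k, s), rfl⟩

variable {F : Type u} [Field F] {LA LB α β γ m p n K : ℕ} (D : FCCChoice F m p n LA K)

/-- The bilinear algorithm, applied to matrices of blocks. -/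
theorem mul_blockIndex (hp : p ∣ β) (ω : Data F LA LB α β γ) (i : Fin LA) (j : Fin LB) (k : Fin m)
    (s : Fin (α / m)) (l : Fin n) (t : Fin (γ / n)) :
    (ω.1 i * ω.2 j) (blockIndex k s) (blockIndex l t) =
      ∑ r, D.tensors.c r k l * entry D s t i r j r ω := by
  have h1 : ∀ w : Fin (β / p),
      ∑ v : Fin p, ω.1 i (blockIndex k s) (blockIndex v w) *
        ω.2 j (blockIndex v w) (blockIndex l t)
      = ∑ r, D.tensors.c r k l * (D.subA r (ω.1 i) s w * D.subB r (ω.2 j) w t) := by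
    intro w
    have h2 := D.tensors.computes (Matrix.of fun k v => ω.1 i (blockIndex k s) (blockIndex v w))
      (Matrix.of fun v l => ω.2 j (blockIndex v w) (blockIndex l t)) k l
    rw [Matrix.mul_apply] at h2
    simp only [Matrix.of_apply] at h2
    rw [← h2]
    refine sum_congr rfl fun r _ => ?_
    simp only [FCCChoice.subA, FCCChoice.subB, Matrix.sum_apply, Matrix.smul_apply, matrixBlock,
      Matrix.of_apply, smul_eq_mul, mul_assoc]
  rw [Matrix.mul_apply, sum_blockIndex hp, sum_comm, sum_congr rfl fun w _ => h1 w, sum_comm]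
  refine sum_congr rfl fun r _ => ?_
  rw [entry, Matrix.mul_apply, mul_sum]

end Blocks

/-! ### Existence of the construction -/

section Existence

variable (F : Type u) [Field F] (m p n : ℕ)

theorem nonempty_bilinearAlgorithm :
    Nonempty (BilinearAlgorithm F m p n (bilinearComplexity F m p n)) := by
  refine Nat.sInf_mem (s := {R | Nonempty (BilinearAlgorithm F m p n R)})
    ⟨Fintype.card (Fin m × Fin p × Fin n), ⟨?_⟩⟩
  -- the definition of the matrix product, with one multiplication for each triple of indices
  set e := (Fintype.equivFin (Fin m × Fin p × Fin n)).symm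
  refine ⟨fun r q l => if (e r).1 = q ∧ (e r).2.1 = l then 1 else 0,
    fun r l s => if (e r).2.1 = l ∧ (e r).2.2 = s then 1 else 0,
    fun r j k => if (e r).1 = j ∧ (e r).2.2 = k then 1 else 0, fun A B j k => ?_⟩
  rw [e.sum_comp (fun x : Fin m × Fin p × Fin n => (if x.1 = j ∧ x.2.2 = k then (1 : F) else 0) *
    (∑ q, ∑ l, (if x.1 = q ∧ x.2.1 = l then 1 else 0) * A q l) *
    (∑ l, ∑ s, (if x.2.1 = l ∧ x.2.2 = s then 1 else 0) * B l s)), Matrix.mul_apply]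
  simp [Fintype.sum_prod_type, ite_and]

variable {m p n}

theorem bilinearComplexity_pos (hm : 0 < m) (hp : 0 < p) (hn : 0 < n) :
    0 < bilinearComplexity F m p n := by
  obtain ⟨T⟩ := nonempty_bilinearAlgorithm F m p n
  by_contra h0
  have : IsEmpty (Fin (bilinearComplexity F m p n)) := by
    rw [Nat.eq_zero_of_not_pos h0]; infer_instance
  have h1 := T.computes (Matrix.of fun _ l => if l = ⟨0, hp⟩ then 1 else 0) (Matrix.of fun _ _ => 1)
    ⟨0, hm⟩ ⟨0, hn⟩
  rw [Matrix.mul_apply] at h1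
  simp at h1

theorem nonempty_fccChoice [Fintype F] {LA K : ℕ}
    (h : bilinearComplexity F m p n * LA + K < Fintype.card F) :
    Nonempty (FCCChoice F m p n LA K) := by
  obtain ⟨T⟩ := nonempty_bilinearAlgorithm F m p n
  obtain ⟨e⟩ := Function.Embedding.nonempty_of_card_le
    (α := (Fin (bilinearComplexity F m p n) × Fin LA) ⊕ Fin K) (β := F) (by simpa using h.le)
  refine ⟨⟨T, fun r q => e (Sum.inl (r, q)), fun k => e (Sum.inr k), ?_⟩⟩
  convert e.injective using 1
  funext x
  rcases x with ⟨r, q⟩ | k <;> rfl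

end Existence

end FastDecoding

namespace FastDecoding

/-! ### Asymptotic bounds -/

theorem two_pow_clog_le {N : ℕ} (hN : 1 < N) : 2 ^ Nat.clog 2 N ≤ 2 * (N - 1) := by
  have h1 := Nat.pow_pred_clog_lt_self (b := 2) (by norm_num) hN
  have h2 := Nat.clog_pos (b := 2) (by norm_num) hN
  obtain ⟨k, hk⟩ : ∃ k, Nat.clog 2 N = k + 1 := ⟨Nat.clog 2 N - 1, by omega⟩
  rw [hk, Nat.pred_succ] at h1
  rw [hk, pow_succ]
  omega

theorem clog_le_log {N : ℕ} (hN : 1 < N) :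
    (Nat.clog 2 N : ℝ) ≤ 1 + 3 / 2 * Real.log (N - 1 : ℕ) := by
  have h1 := two_pow_clog_le hN
  have h2 := Nat.clog_pos (b := 2) (by norm_num) hN
  obtain ⟨k, hk⟩ : ∃ k, Nat.clog 2 N = k + 1 := ⟨Nat.clog 2 N - 1, by omega⟩
  rw [hk, pow_succ] at h1
  have h3 : (2 : ℝ) ^ k ≤ (N - 1 : ℕ) := by exact_mod_cast (show 2 ^ k ≤ N - 1 by omega)
  have h4 := Real.log_le_log (by positivity) h3
  rw [Real.log_pow] at h4
  have h5 := Real.log_two_gt_d9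
  have h6 : (0 : ℝ) ≤ k := Nat.cast_nonneg k
  rw [hk]
  push_cast
  nlinarith

/-- `interpolationCost N` is of the order of `N * log N ^ 2 * log (log N)`. From `N = 3` on,
`log (log N)` is bounded away from `0`, so that the constant terms can be absorbed. -/
theorem interpolationCost_le {N : ℕ} (hN : 3 ≤ N) : (interpolationCost N : ℝ) ≤
    5000000 * (N * Real.log N ^ 2 * Real.log (Real.log N)) := by
  have hN' : (3 : ℝ) ≤ N := by exact_mod_cast hN
  set x := Real.log N with hx
  have hx1 : 1.09 ≤ x := by
    have h1 := Real.exp_one_lt_d9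
    have h2 : Real.log 3 = 1 + Real.log (3 / Real.exp 1) := by
      rw [Real.log_div (by norm_num) (Real.exp_pos 1).ne', Real.log_exp]; ring
    have h3 := Real.one_sub_inv_le_log_of_pos (x := 3 / Real.exp 1) (by positivity)
    have h4 := Real.log_le_log (by norm_num) hN'
    rw [inv_div] at h3
    linarith
  set y := Real.log x with hy
  have hy1 : 0.08 ≤ y := by
    have h1 := Real.one_sub_inv_le_log_of_pos (x := x) (by linarith)
    have h2 : x⁻¹ ≤ (1.09 : ℝ)⁻¹ := inv_anti₀ (by norm_num) hx1
    have h3 : (1.09 : ℝ)⁻¹ ≤ 0.92 := by norm_num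
    linarith
  set κ := Nat.clog 2 N with hκ
  have hκ1 : (κ : ℝ) ≤ 3 * x := by
    have h1 := clog_le_log (N := N) (by omega)
    have h2 : Real.log (N - 1 : ℕ) ≤ x :=
      Real.log_le_log (by exact_mod_cast (show 0 < N - 1 by omega))
        (by exact_mod_cast (show N - 1 ≤ N by omega))
    linarith
  have hκ0 : 0 < κ := Nat.clog_pos (by norm_num) (by omega)
  have hκ0' : (0 : ℝ) < κ := by exact_mod_cast hκ0
  have hpow : (2 : ℝ) ^ κ ≤ 2 * N := by
    have h1 := two_pow_clog_le (N := N) (by omega)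
    exact_mod_cast h1.trans (by omega)
  set s := Nat.clog 2 (κ + 1) with hs
  have hs1 : (s : ℝ) ≤ 52 * y := by
    have h1 := clog_le_log (N := κ + 1) (by omega)
    rw [Nat.add_sub_cancel] at h1
    have h2 : Real.log κ ≤ Real.log 3 + y := by
      rw [hy, ← Real.log_mul (by norm_num) (by linarith)]
      exact Real.log_le_log hκ0' hκ1
    have h3 := Real.log_le_sub_one_of_pos (x := 3) (by norm_num)
    linarith
  have hspow : (2 : ℝ) ^ s ≤ 6 * x := by
    have h1 := two_pow_clog_le (N := κ + 1) (by omega)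
    rw [Nat.add_sub_cancel] at h1
    have h2 : (2 : ℝ) ^ s ≤ 2 * κ := by exact_mod_cast h1
    linarith
  have hxy : 0.0872 ≤ x * y := by nlinarith
  have hmul : (mulCost κ : ℝ) ≤ 109900 * (x * y) := by
    rw [mulCost]
    push_cast
    calc (2 : ℝ) ^ s * (342 + 270 * s) ≤ (6 * x) * (18315 * y) :=
          mul_le_mul hspow (by linarith) (by positivity) (by linarith)
      _ ≤ 109900 * (x * y) := by nlinarith
  have h1 : (7 * mulCost κ + 4 : ℝ) ≤ 770000 * (x * y) := by linarith
  have h2 : (2 : ℝ) ^ κ * κ ≤ 2 * N * (3 * x) :=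
    mul_le_mul hpow hκ1 hκ0'.le (by positivity)
  have h3 : (2 : ℝ) ^ κ * κ * (7 * mulCost κ + 4) ≤ 2 * N * (3 * x) * (770000 * (x * y)) :=
    mul_le_mul h2 h1 (by positivity) (by nlinarith)
  have h4 : 1 ≤ 20 * (x ^ 2 * y) := by nlinarith
  rw [interpolationCost]
  push_cast
  nlinarith

/-- For `N = 2` the term `N * log N ^ 2 * log (log N)` is negative, but small. -/
theorem interpolationCost_le_add {N : ℕ} {a b : ℝ} (hN : 0 < N) (ha : 1 ≤ a) (hb : 1 ≤ b) :
    (interpolationCost N : ℝ) + 2 * a + 2 * b ≤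
      5000002 * (a + (N * Real.log N ^ 2 * Real.log (Real.log N) + b)) := by
  rcases Nat.lt_or_ge N 3 with h | h
  · have hcost : interpolationCost N ≤ 20000 := by
      interval_cases N
      · simp [interpolationCost]
      · have h1 : Nat.clog 2 2 = 1 := by
          rw [Nat.clog_eq_one (by norm_num) (by norm_num)]
        simp [interpolationCost, mulCost, h1]
    have hcost' : (interpolationCost N : ℝ) ≤ 20000 := by exact_mod_cast hcost
    have hlog : -1 ≤ (N : ℝ) * Real.log N ^ 2 * Real.log (Real.log N) := by
      interval_cases N
      · simp
      · have h1 := Real.log_two_gt_d9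
        have h2 := Real.log_two_lt_d9
        have h3 := Real.one_sub_inv_le_log_of_pos (x := Real.log 2) (by linarith)
        have h4 : (Real.log 2)⁻¹ ≤ (0.69 : ℝ)⁻¹ := inv_anti₀ (by norm_num) (by linarith)
        have h5 : (0.69 : ℝ)⁻¹ ≤ 1.5 := by norm_num
        have h6 : Real.log 2 ^ 2 ≤ 0.5 := by nlinarith
        push_cast
        nlinarith [sq_nonneg (Real.log 2)]
    linarith
  · have h1 := interpolationCost_le h
    have h2 : (0 : ℝ) ≤ interpolationCost N := Nat.cast_nonneg _
    linarith

end FastDecoding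

theorem mainTheorem6 :
    ∃ C : ℝ, 0 < C ∧
      ∀ (F : Type u) [Field F] [Fintype F]
        (LA LB α β γ m p n ρ K : ℕ) (S : Finset (Fin LA × Fin LB)),
        0 < LA → 0 < LB → (∀ i, 0 < degA S i) → (∀ j, 0 < degB S j) →
        0 < α → 0 < β → 0 < γ → 0 < m → 0 < p → 0 < n →
        m ∣ α → p ∣ β → n ∣ γ → ρ ∣ bilinearComplexity F m p n →
        bilinearComplexity F m p n * LA + K < Fintype.card F →
        ∀ P : PowerAssignment (type2Task S),
          Nonempty (FCCChoice F m p n LA K) ∧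
          ∀ D : FCCChoice F m p n LA K,
            let R : ℕ := bilinearComplexity F m p n
            let N : ℤ := type2Threshold S P R ρ
            ∃ d : ∀ W : Finset (Fin K),
                StraightLineProgram F (W × Fin (α / m) × Fin (γ / n)) (S × Fin α × Fin γ),
              ∀ W : Finset (Fin K), N ≤ #W →
                (∀ (𝒜 : Fin LA → Matrix (Fin α) (Fin β) F)
                    (ℬ : Fin LB → Matrix (Fin β) (Fin γ) F),
                  (d W).eval (fun kst => D.response P ρ 𝒜 ℬ kst.1 kst.2.1 kst.2.2) =
                    fun ijst => (𝒜 ijst.1.1.1 * ℬ ijst.1.1.2) ijst.2.1 ijst.2.2) ∧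
                ((d W).cost : ℝ) ≤
                  C * (α * γ * R * #S) +
                  C * (α * γ *
                    (N * Real.log N ^ 2 * Real.log (Real.log N) + R * (#S : ℝ) ^ 2)) := by
  classical
  refine ⟨5000002, by norm_num, ?_⟩
  intro F _ _ LA LB α β γ m p n ρ K S hLA _ hS _ hα _ hγ hm hp hn hmα hpβ hnγ hρ hF P
  refine ⟨FastDecoding.nonempty_fccChoice F hF, fun D => ?_⟩
  intro R N
  have hR : 0 < R := FastDecoding.bilinearComplexity_pos F hm hp hn
  have hρ0 : 0 < ρ := Nat.pos_of_ne_zero fun h0 => by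
    rw [h0, zero_dvd_iff] at hρ
    exact hR.ne' hρ
  have hScard : 0 < #S := (hS ⟨0, hLA⟩).trans_le (FastDecoding.degA_le_card S _)
  have hRSN : ((R * #S : ℕ) : ℤ) ≤ N := FastDecoding.mul_card_le_type2Threshold P hLA hS R hρ0
  have hRS : 0 < R * #S := Nat.mul_pos hR hScard
  obtain ⟨M, hM⟩ : ∃ M : ℕ, (M : ℤ) = N := ⟨N.toNat, Int.toNat_of_nonneg (by omega)⟩
  have key : ∀ W : Finset (Fin K), N ≤ #W →
      ∃ d : StraightLineProgram F (W × Fin (α / m) × Fin (γ / n)) (S × Fin α × Fin γ),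
        d.cost ≤ α * γ * (FastDecoding.interpolationCost M + 2 * (R * #S ^ 2))
          + #S * (α * γ) * (2 * R) ∧
        ∀ ω : FastDecoding.Data F LA LB α β γ,
          d.eval (fun kst => D.response P ρ ω.1 ω.2 kst.1 kst.2.1 kst.2.2) =
            fun ijst => (ω.1 ijst.1.1.1 * ω.2 ijst.1.1.2) ijst.2.1 ijst.2.2 := by
    intro W hW
    obtain ⟨W', hW', hcard⟩ := exists_subset_card_eq (s := W) (n := M) (by omega)
    set inp : W × Fin (α / m) × Fin (γ / n) → FastDecoding.Data F LA LB α β γ → F :=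
      fun kst ω => D.response P ρ ω.1 ω.2 kst.1 kst.2.1 kst.2.2 with hinp
    have h1 := FastDecoding.Computes.biUnion (A := Set.range inp)
      (univ : Finset (Fin (α / m) × Fin (γ / n)))
      (fun _ => FastDecoding.interpolationCost M + 2 * (R * #S ^ 2))
      (fun st => {φ | ∃ r, ∃ x ∈ S, φ = FastDecoding.entry D st.1 st.2 x.1 r x.2 r})
      fun st _ => (FastDecoding.computes_entries D P hLA hS hρ hρ0 hM hcard st.1 st.2).mono_source
        (by
          rintro _ ⟨k, hk, rfl⟩
          exact Or.inl ⟨(⟨k, hW' hk⟩, st), rfl⟩)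
    rw [sum_const, card_univ, Fintype.card_prod, Fintype.card_fin, Fintype.card_fin,
      smul_eq_mul] at h1
    have h2 := h1.trans (FastDecoding.Computes.range (c := 2 * R)
      (fun (z : S × Fin α × Fin γ) (ω : FastDecoding.Data F LA LB α β γ) =>
        (ω.1 z.1.1.1 * ω.2 z.1.1.2) z.2.1 z.2.2) fun z => by
      obtain ⟨k, s, hks⟩ := FastDecoding.exists_blockIndex hmα z.2.1
      obtain ⟨l, t, hlt⟩ := FastDecoding.exists_blockIndex hnγ z.2.2
      have h3 := FastDecoding.Computes.linear_combination
        (A := ⋃ st ∈ (univ : Finset (Fin (α / m) × Fin (γ / n))),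
          {φ | ∃ r, ∃ x ∈ S, φ = FastDecoding.entry (α := α) (β := β) (γ := γ) D st.1 st.2 x.1 r
            x.2 r}) univ
        (fun r => D.tensors.c r k l)
        (fun r => FastDecoding.entry (α := α) (β := β) (γ := γ) D s t z.1.1.1 r z.1.1.2 r)
        fun r _ => Or.inl (Set.mem_biUnion (x := (s, t)) (by simp) ⟨r, z.1.1, z.1.2, rfl⟩)
      rw [card_univ, Fintype.card_fin] at h3
      convert h3 using 2
      funext ω
      rw [hks, hlt, FastDecoding.mul_blockIndex D hpβ])
    obtain ⟨d, hd, hd'⟩ := h2.exists_program inp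
      (fun (z : S × Fin α × Fin γ) (ω : FastDecoding.Data F LA LB α β γ) =>
        (ω.1 z.1.1.1 * ω.2 z.1.1.2) z.2.1 z.2.2) fun z => Or.inl ⟨z, rfl⟩
    refine ⟨d, hd.trans ?_, hd'⟩
    simp only [Fintype.card_prod, Fintype.card_fin, Fintype.card_coe]
    gcongr
    · exact Nat.div_le_self _ _
    · exact Nat.div_le_self _ _
  have key' : ∀ W : Finset (Fin K),
      ∃ d : StraightLineProgram F (W × Fin (α / m) × Fin (γ / n)) (S × Fin α × Fin γ), N ≤ #W →
        d.cost ≤ α * γ * (FastDecoding.interpolationCost M + 2 * (R * #S ^ 2))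
          + #S * (α * γ) * (2 * R) ∧
        ∀ ω : FastDecoding.Data F LA LB α β γ,
          d.eval (fun kst => D.response P ρ ω.1 ω.2 kst.1 kst.2.1 kst.2.2) =
            fun ijst => (ω.1 ijst.1.1.1 * ω.2 ijst.1.1.2) ijst.2.1 ijst.2.2 := by
    intro W
    by_cases hW : N ≤ #W
    · obtain ⟨d, hd⟩ := key W hW
      exact ⟨d, fun _ => hd⟩
    · exact ⟨⟨[], fun _ => .const 0⟩, fun h => absurd h hW⟩
  choose d hd using key'
  refine ⟨d, fun W hW => ⟨fun 𝒜 ℬ => (hd W hW).2 (𝒜, ℬ), ?_⟩⟩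
  have h1 : ((d W).cost : ℝ) ≤ α * γ * (FastDecoding.interpolationCost M + 2 * (R * (#S : ℝ) ^ 2))
      + #S * (α * γ) * (2 * R) := by exact_mod_cast (hd W hW).1
  have ha : (1 : ℝ) ≤ R * #S := by exact_mod_cast hRS
  have hb : (1 : ℝ) ≤ R * (#S : ℝ) ^ 2 := by
    exact_mod_cast Nat.mul_pos hR (pow_pos hScard 2)
  have h2 := FastDecoding.interpolationCost_le_add (N := M) (by zify; omega) ha hb
  have h3 : ((M : ℕ) : ℝ) = (N : ℝ) := by exact_mod_cast congrArg (Int.cast : ℤ → ℝ) hM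
  rw [h3] at h2
  have h4 := mul_le_mul_of_nonneg_left h2 (by positivity : (0 : ℝ) ≤ α * γ)
  linarith
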